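/- Let $2\le m<n$ be integers, let $\mathcal D\subset\{0,\dots,n-1\}\times\{0,\dots,m-1\}$ with $N=\#\mathcal D>1$, and let $E=K(n,m,\mathcal D)\subset\mathbb R^2$ be the Bedford–McMullen carpet of $\mathcal D$, i.e. the unique nonempty compact set with $E=\bigcup_{d\in\mathcal D}S_d(E)$, where $S_d(z)=\mathrm{diag}(n^{-1},m^{-1})(z+d)$. Put $a_j=\#\{i:(i,j)\in\mathcal D\}$ for $0\le j\le m-1$ and $s=\#\{j:a_j>0\}$. Assume that $E$ is totally disconnected, that $a_j=0$ for some $j$ (vacant rows), and that all nonzero $a_j$ are equal (uniform horizontal fibers). Let $\sigma=\log m/\log n$, $\alpha=1/\sigma-\lfloor 1/\sigma\rfloor$, and for $k\ge1$ let $\delta_k=\lfloor k\alpha\rfloor-\lfloor(k-1)\alpha\rfloor$ and $n_k=N s^{\lfloor 1/\sigma\rfloor+\delta_k-1}$. For $0<\xi<1$, let $d_\xi(x,y)=\xi^{|x\wedge y|}$ for sequences $x\ne y$, where $|x\wedge y|$ is the length of their longest common prefix, and $d_\xi(x,x)=0$. Two metric spaces are called bi-Lipschitz equivalent, written $\sim$,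 if there is a bi-Lipschitz bijection between them. With the Euclidean metric on $E$, the following hold. 1. $E\sim(\Omega,d_{1/n})$, where $\Omega=\prod_{k=1}^\infty\{0,1,\dots,n_k-1\}$. 2. If $\sigma=p/q$ with positive integers $p,q$, then $E\sim(\{0,1,\dots,N^*-1\}^\infty,d_{1/n^p})$, where $N^*=N^ps^{q-p}$. 3. Let $T$ be a rooted tree in which, for every $k\ge1$, every vertex of level $k-1$ (distance $k-1$ from the root) has exactly $n_k$ direct offsprings (neighbours of level $k$). Let $\partial T$ be the set of infinite paths $(v_k)_{k\ge0}$ from the root, $v_k$ being of level $k$, with the metric $d_{1/n}$ given by the number of common initial edges of two paths (that is, the metric $d_{1/n}$ above applied to the sequences $(v_k)_{k\ge1}$). Then $E\sim(\partial T,d_{1/n})$. -/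

import Mathlib

noncomputable section

namespace Carpet

/-! ### Bi-Lipschitz equivalence -/

/-- `(X, dX)` and `(Y, dY)` are bi-Lipschitz equivalent: there is a bi-Lipschitz bijection
from `X` onto `Y`. -/
def LipEquiv {X Y : Type*} (dX : X → X → ℝ) (dY : Y → Y → ℝ) : Prop :=
  ∃ f : X → Y, Function.Bijective f ∧ ∃ C : ℝ, 0 < C ∧
    ∀ x x' : X, C⁻¹ * dX x x' ≤ dY (f x) (f x') ∧ dY (f x) (f x') ≤ C * dX x x'

/-! ### Bedford–McMullen carpets -/

/-- The affine contraction `S_d(z) = diag(n⁻¹, m⁻¹)(z + d)` of the Euclidean plane. -/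
def S (n m : ℕ) (d : Fin n × Fin m) (z : EuclideanSpace ℝ (Fin 2)) :
    EuclideanSpace ℝ (Fin 2) :=
  !₂[(z 0 + (d.1 : ℕ)) / n, (z 1 + (d.2 : ℕ)) / m]

/-- `E = K(n, m, D)`: the set `E` is the (unique) nonempty compact set satisfying
`E = ⋃_{d ∈ D} S_d(E)`. -/
def IsCarpet (n m : ℕ) (D : Finset (Fin n × Fin m)) (E : Set (EuclideanSpace ℝ (Fin 2))) :
    Prop :=
  E.Nonempty ∧ IsCompact E ∧ E = ⋃ d ∈ D, S n m d '' E

/-- `a_j = #{i : (i, j) ∈ D}`, the number of digits in the row `j`. -/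
def rowCount {n m : ℕ} (D : Finset (Fin n × Fin m)) (j : Fin m) : ℕ :=
  (D.filter (fun d => d.2 = j)).card

/-- `s = #{j : a_j > 0}`, the number of non-vacant rows. -/
def numRows {n m : ℕ} (D : Finset (Fin n × Fin m)) : ℕ :=
  (Finset.univ.filter (fun j : Fin m => 0 < rowCount D j)).card

/-- Some row is vacant. -/
def HasVacantRow {n m : ℕ} (D : Finset (Fin n × Fin m)) : Prop :=
  ∃ j : Fin m, rowCount D j = 0

/-- Uniform horizontal fibers: all nonzero `a_j` are equal. -/
def UniformFibers {n m : ℕ} (D : Finset (Fin n × Fin m)) : Prop :=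
  ∀ i j : Fin m, 0 < rowCount D i → 0 < rowCount D j → rowCount D i = rowCount D j

/-! ### The sequence `n_k` -/

/-- `σ = log m / log n`. -/
def sigma (n m : ℕ) : ℝ := Real.log m / Real.log n

/-- `α = 1/σ - ⌊1/σ⌋`. -/
def alpha (n m : ℕ) : ℝ := 1 / sigma n m - (⌊1 / sigma n m⌋ : ℤ)

/-- `δ_k = ⌊kα⌋ - ⌊(k-1)α⌋`, for `k ≥ 1`. -/
def delta (n m k : ℕ) : ℤ := ⌊(k : ℝ) * alpha n m⌋ - ⌊((k : ℝ) - 1) * alpha n m⌋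

/-- The exponent `⌊1/σ⌋ + δ_k - 1`. -/
def expo (n m k : ℕ) : ℤ := ⌊1 / sigma n m⌋ + delta n m k - 1

/-- The exponent is nonnegative, so that it may be read as a natural number. -/
theorem expo_nonneg {n m : ℕ} (hm : 2 ≤ m) (hmn : m < n) (k : ℕ) : 0 ≤ expo n m k := by
  have h1 : 0 < Real.log m := Real.log_pos (by exact_mod_cast (by omega : 1 < m))
  have h2 : Real.log m ≤ Real.log n :=
    Real.log_le_log (by exact_mod_cast (by omega : 0 < m)) (by exact_mod_cast hmn.le)
  have h3 : (1 : ℤ) ≤ ⌊1 / sigma n m⌋ := by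
    rw [Int.le_floor, sigma, one_div_div, Int.cast_one]
    exact (one_le_div h1).2 h2
  have h4 : 0 ≤ alpha n m := sub_nonneg.2 (Int.floor_le _)
  have h5 : 0 ≤ delta n m k := by
    rw [delta, sub_nonneg]
    exact Int.floor_le_floor (mul_le_mul_of_nonneg_right (by linarith) h4)
  rw [expo]
  omega

/-- `n_k = N s^(⌊1/σ⌋ + δ_k - 1)` for `k ≥ 1`, where `N = #D`. -/
def nSeq {n m : ℕ} (D : Finset (Fin n × Fin m)) (k : ℕ) : ℕ :=
  D.card * numRows D ^ (expo n m k).toNat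

/-! ### Symbolic spaces -/

open Classical in
/-- `d_ξ(x, y) = ξ^|x ∧ y|`, where `|x ∧ y|` is the length of the maximal common prefix of
`x` and `y`; the distance is `0` if `x = y`. For `x ≠ y`, `PiNat.firstDiff x y` is the least
(zero-based) index where `x` and `y` differ. -/
def prefixDist {A : ℕ → Type*} (ξ : ℝ) (x y : (k : ℕ) → A k) : ℝ :=
  if x = y then 0 else ξ ^ PiNat.firstDiff x y

/-- `Ω = ∏_{k ≥ 1} {0, …, n_k - 1}`; the factor with the zero-based index `k` is
`{0, …, n_{k+1} - 1}`. -/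
abbrev Omega {n m : ℕ} (D : Finset (Fin n × Fin m)) : Type :=
  (k : ℕ) → Fin (nSeq D (k + 1))

/-! ### Rooted trees and their boundaries -/

/-- The direct offsprings of the vertex `v` of the tree `T` with root `r`: the neighbours of `v`
whose level (distance from the root) is one more than that of `v`. -/
def offspring {V : Type*} (T : SimpleGraph V) (r v : V) : Set V :=
  {w | T.Adj v w ∧ T.dist r w = T.dist r v + 1}

/-- `T` is a tree with root `r` in which every vertex of level `k - 1` has exactly `c k`
direct offsprings, for every `k ≥ 1`. -/
def IsHomogeneousTree {V : Type*} (T : SimpleGraph V) (r : V) (c : ℕ → ℕ) : Prop :=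
  T.IsTree ∧ ∀ v : V, (offspring T r v).encard = c (T.dist r v + 1)

/-- The boundary of `T`: the infinite paths `v₀ v₁ v₂ …` emanating from the root, `v_k` being of
level `k`. -/
def Boundary {V : Type*} (T : SimpleGraph V) (r : V) : Type _ :=
  {v : ℕ → V // v 0 = r ∧ ∀ k, v (k + 1) ∈ offspring T r (v k)}

/-- `d_ξ` on the boundary: `ξ` to the power of the number of edges of the common initial part.
The root, which all paths share, is not counted. -/
def boundaryDist {V : Type*} (T : SimpleGraph V) (r : V) (ξ : ℝ) (u v : Boundary T r) : ℝ :=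
  prefixDist ξ (fun k => u.1 (k + 1)) (fun k => v.1 (k + 1))

end Carpet

end

/-!
# Bedford–McMullen carpets with vacant rows and uniform fibers as sequence spaces

All three target spaces are sequence spaces, or boundaries of trees, with prescribed branching
numbers; grouping levels into blocks (`lipEquiv_blocks`) and numbering the children of each vertex
(`lipEquiv_boundary`) are bi-Lipschitz, so that everything reduces to coding `E` by *some* sequence
space `∏ Fin (c K)` whose branching agrees with that of `Ω` along a sequence of levels.

Let `a` be the common number of digits in the nonvacant rows and `s` the number of these rows. Total
disconnectedness gives `a < n`, since a full row would produce a horizontal segment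
(`SelfAffine.not_full_row`). At the scale `n ^ (-k)` the carpet is covered by `a ^ k * s ^ l`
approximate squares, `l = ⌊k / σ⌋`, which form a tree with the right branching: passing from `k` to
`k + 1` multiplies their number by `n_{k+1}`. This tree does not describe the metric, because
approximate squares may touch. They are therefore grouped into clusters: vertically, the carpet is
cut in the vacant row into slabs of bounded height; in each slab only at most two words of rows
matter for the columns, so that because of `2 * a ^ t < n ^ t` there is a word of columns of bounded
length that is vacant for the whole slab, at which the slab is cut horizontally. Squares with the
same `label` (numbers of the slab and of the interval in it) are at distance `≲ n ^ (-k)`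
(`dist_le_of_label_eq`), others are at distance `≥ n ^ (-k)` (`le_dist_of_label_ne`).

The main point is that the approximate squares can be given new parents, in the cluster of the true
parent, so that all squares of a cluster have the same parent while the number of children of each
square is the old one (`exists_parent`). Then a point of `E` is determined by a path in the new
tree, and the length of the common part of two paths measures the distance of the points
(`lipEquiv_of_clusters`). The existence of new parents is a matter of counting. In one
dimension, cutting each of finitely many equal blocks at the same vacant place and moving the part
above the cut to the next block, cyclically, leaves the blocks equally large
(`card_filter_cycRank_cut`) and respects the clusters. In the plane the same is done in both
coordinates. The only clusters this does not respect lie in the middle slab where two words of rows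
with different columns meet; they are so few, when many levels are passed at once, that all of them
can be given the same parent (`exists_distribution`).
-/

noncomputable section

namespace Carpet

/-! ### Bi-Lipschitz equivalence and sequence spaces -/

theorem LipEquiv.symm {X Y : Type*} {dX : X → X → ℝ} {dY : Y → Y → ℝ} (h : LipEquiv dX dY) :
    LipEquiv dY dX := by
  obtain ⟨f, hf, C, hC, h⟩ := h
  let e := Equiv.ofBijective f hf
  refine ⟨e.symm, e.symm.bijective, C, hC, fun y y' => ?_⟩
  obtain ⟨x, rfl⟩ := e.surjective y
  obtain ⟨x', rfl⟩ := e.surjective y'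
  rw [e.symm_apply_apply, e.symm_apply_apply]
  obtain ⟨h1, h2⟩ := h x x'
  exact ⟨(inv_mul_le_iff₀ hC).2 h2, (inv_mul_le_iff₀ hC).1 h1⟩

theorem LipEquiv.trans {X Y Z : Type*} {dX : X → X → ℝ} {dY : Y → Y → ℝ} {dZ : Z → Z → ℝ}
    (h : LipEquiv dX dY) (h' : LipEquiv dY dZ) : LipEquiv dX dZ := by
  obtain ⟨f, hf, C, hC, h⟩ := h
  obtain ⟨g, hg, C', hC', h'⟩ := h'
  refine ⟨g ∘ f, hg.comp hf, C' * C, by positivity, fun x x' => ⟨?_, ?_⟩⟩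
  · rw [mul_inv, mul_assoc]
    exact (mul_le_mul_of_nonneg_left (h x x').1 (by positivity)).trans (h' _ _).1
  · rw [mul_assoc]
    exact (h' _ _).2.trans (mul_le_mul_of_nonneg_left (h x x').2 hC'.le)

open Classical in
/-- The distance on a product of discrete spaces which is `ρ k` between two sequences that first
differ at the index `k`; `prefixDist ξ` is the case `ρ k = ξ ^ k`. -/
def levelDist {A : ℕ → Type*} (ρ : ℕ → ℝ) (x y : (k : ℕ) → A k) : ℝ :=
  if x = y then 0 else ρ (PiNat.firstDiff x y)

theorem prefixDist_eq_levelDist {A : ℕ → Type*} (ξ : ℝ) :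
    (prefixDist ξ : ((k : ℕ) → A k) → _ → ℝ) = levelDist fun k => ξ ^ k := rfl

/-- Coding criterion. If the points of `X` correspond bijectively to the infinite paths of a
levelled structure in which every vertex of level `K` has `c K` children, and the distance of two
points is comparable with `ρ K` when their paths split after level `K`, then `X` is bi-Lipschitz
equivalent to the sequence space `∏ K, Fin (c K)` with the distance given by `ρ`. -/
theorem lipEquiv_levelDist {X : Type*} {V : ℕ → Type*} {dX : X → X → ℝ} {c : ℕ → ℕ} {ρ : ℕ → ℝ}
    (ch : ∀ K, V K → Set (V (K + 1))) (hch : ∀ K v, (ch K v).encard = c K) (v₀ : V 0)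
    (f : X → ∀ K, V K) (hf0 : ∀ x, f x 0 = v₀) (hf : ∀ x K, f x (K + 1) ∈ ch K (f x K))
    (hsurj : ∀ v : ∀ K, V K, v 0 = v₀ → (∀ K, v (K + 1) ∈ ch K (v K)) → ∃ x, f x = v)
    (hinj : Function.Injective f) (hd : ∀ x, dX x x = 0) {C : ℝ} (hC : 1 ≤ C)
    (hle : ∀ x x' K, x ≠ x' → (∀ i ≤ K, f x i = f x' i) → dX x x' ≤ C * ρ K)
    (hge : ∀ x x' K, f x K ≠ f x' K → ρ K ≤ C * dX x x')
    (hρ0 : ∀ K, 0 ≤ ρ K) (hρ : ∀ K, ρ K ≤ C * ρ (K + 1)) :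
    LipEquiv dX (levelDist ρ : (∀ K, Fin (c K)) → _ → ℝ) := by
  have key : ∀ K v, ∃ F : V (K + 1) → ℕ, Set.BijOn F (ch K v) (Set.Iio (c K)) := fun K v => by
    refine Set.Finite.exists_bijOn_of_encard_eq ?_ ?_
    · rw [← Set.encard_lt_top_iff, hch]
      exact WithTop.coe_lt_top _
    · rw [hch, ← Finset.coe_Iio, Set.encard_coe_eq_coe_finsetCard, Nat.card_Iio]
  choose F hF using key
  let g : X → ∀ K, Fin (c K) := fun x K => ⟨F K (f x K) (f x (K + 1)), (hF _ _).mapsTo (hf x K)⟩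
  have hg : ∀ x x' K, (∀ i < K, g x i = g x' i) → ∀ i ≤ K, f x i = f x' i := by
    intro x x' K hK i hi
    induction i with
    | zero => rw [hf0, hf0]
    | succ i ih =>
      have h1 := ih (by omega)
      have h2 := congrArg Fin.val (hK i hi)
      simp only [g] at h2
      have h3 := hf x' i
      rw [← h1] at h2 h3
      exact (hF i _).injOn (hf x i) h3 h2
  have hgf : ∀ x x' K, g x K ≠ g x' K → (f x K = f x' K) → f x (K + 1) ≠ f x' (K + 1) := by
    intro x x' K h h1 h2
    apply h
    refine Fin.ext ?_
    change F K (f x K) (f x (K + 1)) = F K (f x' K) (f x' (K + 1))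
    rw [h1, h2]
  have hginj : Function.Injective g := fun x x' h =>
    hinj (funext fun K => hg x x' K (fun i _ => congrFun h i) K le_rfl)
  have hgsurj : Function.Surjective g := by
    intro s
    have hstep : ∀ K v, ∃ w ∈ ch K v, F K v w = (s K : ℕ) := fun K v => (hF K v).surjOn (s K).2
    choose nx hnx hnx' using hstep
    let v : ∀ K, V K := fun K => Nat.rec v₀ (fun K w => nx K w) K
    obtain ⟨x, hx⟩ := hsurj v rfl (fun K => hnx K (v K))
    refine ⟨x, funext fun K => Fin.ext ?_⟩
    simp only [g, hx]
    exact hnx' K (v K)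
  refine ⟨g, ⟨hginj, hgsurj⟩, C * C, by positivity, fun x x' => ?_⟩
  by_cases hx : x = x'
  · subst hx
    simp [levelDist, hd]
  have hgx : g x ≠ g x' := fun h => hx (hginj h)
  rw [levelDist, if_neg hgx]
  set k := PiNat.firstDiff (g x) (g x')
  have hag := hg x x' k (fun i hi => PiNat.apply_eq_of_lt_firstDiff hi)
  have hne := hgf x x' k (PiNat.apply_firstDiff_ne hgx) (hag k le_rfl)
  have h1 := hle x x' k hx hag
  have h2 := hge x x' (k + 1) hne
  have h3 := hρ k
  constructor
  · rw [inv_mul_le_iff₀ (by positivity)]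
    refine h1.trans ?_
    nlinarith [hρ0 k, mul_nonneg (hρ0 k) (by linarith : (0 : ℝ) ≤ C)]
  · rw [mul_assoc]
    exact h3.trans (mul_le_mul_of_nonneg_left h2 (by linarith))

/-- Grouping the coordinates of a sequence space into the consecutive blocks
`[κ K, κ (K + 1))`. -/
theorem lipEquiv_blocks {a c κ : ℕ → ℕ} {ρ : ℕ → ℝ} {b : ℕ} (hκ0 : κ 0 = 0)
    (hκ : StrictMono κ) (hb : ∀ K, κ (K + 1) ≤ κ K + b)
    (hc : ∀ K, c K = ∏ i ∈ Finset.Ico (κ K) (κ (K + 1)), a i)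
    (hρ0 : ∀ k, 0 ≤ ρ k) (hanti : Antitone ρ) {C : ℝ} (hC : 1 ≤ C)
    (hρ : ∀ k, ρ k ≤ C * ρ (k + 1)) :
    LipEquiv (levelDist ρ : (∀ k, Fin (a k)) → _ → ℝ)
      (levelDist (fun K => ρ (κ K)) : (∀ K, Fin (c K)) → _ → ℝ) := by
  have hC0 : 0 ≤ C := by linarith
  have hpow : ∀ d k, ρ k ≤ C ^ d * ρ (k + d) := by
    intro d k
    induction d with
    | zero => simp
    | succ d ih =>
      rw [pow_succ, mul_assoc]
      exact ih.trans (mul_le_mul_of_nonneg_left (hρ _) (by positivity))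
  let V : ℕ → Type := fun K => ∀ i : {i // i < κ K}, Fin (a i)
  have hmono : ∀ K, κ K ≤ κ (K + 1) := fun K => (hκ (Nat.lt_succ_self K)).le
  let ch : ∀ K, V K → Set (V (K + 1)) := fun K v =>
    {w | ∀ i : {i // i < κ K}, w ⟨i.1, i.2.trans_le (hmono K)⟩ = v i}
  have hpos : ∀ k, ρ k ≤ C ^ b * ρ (k + b) := hpow b
  refine lipEquiv_levelDist (C := C ^ b) (V := V) ch ?_ (fun i => absurd i.2 (by omega))
    (fun x K i => x i) ?_ (fun x K i => rfl) ?_ ?_ (fun x => by simp [levelDist])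
    (one_le_pow₀ hC) ?_ ?_ (fun K => hρ0 _) ?_
  · intro K v
    let e : ch K v ≃ ∀ i : Finset.Ico (κ K) (κ (K + 1)), Fin (a i) :=
      { toFun := fun w i => w.1 ⟨i.1, (Finset.mem_Ico.1 i.2).2⟩
        invFun := fun u => ⟨fun i => if h : i.1 < κ K then v ⟨i.1, h⟩ else
            u ⟨i.1, Finset.mem_Ico.2 ⟨not_lt.1 h, i.2⟩⟩, fun i => dif_pos i.2⟩
        left_inv := by
          rintro ⟨w, hw⟩
          ext i
          dsimp only
          split_ifs with h
          · rw [← hw ⟨i.1, h⟩]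
          · rfl
        right_inv := by
          intro u
          ext i
          dsimp only
          rw [dif_neg (not_lt.2 (Finset.mem_Ico.1 i.2).1)] }
    rw [Set.encard, ENat.card_congr e, ENat.card_eq_coe_fintype_card, Fintype.card_pi, hc]
    simp only [Fintype.card_fin]
    exact congrArg _ (Finset.prod_coe_sort _ _)
  · intro x
    funext i
    exact absurd i.2 (by omega)
  · intro v _ hv
    have hv' : ∀ K L (h : K ≤ L) i (hi : i < κ K) (hi' : i < κ L),
        v L ⟨i, hi'⟩ = v K ⟨i, hi⟩ := by
      intro K L h
      induction L, h using Nat.le_induction with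
      | base => intros; rfl
      | succ L hL ih =>
        intro i hi hi'
        have hiL : i < κ L := hi.trans_le (hκ.monotone hL)
        rw [← ih i hi hiL]
        exact hv L ⟨i, hiL⟩
    refine ⟨fun i => v (i + 1) ⟨i, Nat.lt_of_lt_of_le (Nat.lt_succ_self i) hκ.le_apply⟩, ?_⟩
    funext K i
    rcases le_total K (i + 1) with h | h
    · exact hv' K (i + 1) h i i.2 _
    · exact (hv' (i + 1) K h i _ i.2).symm
  · intro x x' h
    funext i
    exact congrFun (congrFun h (i + 1)) ⟨i, Nat.lt_of_lt_of_le (Nat.lt_succ_self i) hκ.le_apply⟩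
  · intro x x' K hne h
    rw [levelDist, if_neg hne]
    have hle : κ K ≤ PiNat.firstDiff x x' := by
      by_contra! hlt
      exact PiNat.apply_firstDiff_ne hne (congrFun (h K le_rfl) ⟨_, hlt⟩)
    exact (hanti hle).trans (le_mul_of_one_le_left (hρ0 _) (one_le_pow₀ hC))
  · intro x x' K h
    have hne : x ≠ x' := fun h' => h (by rw [h'])
    rw [levelDist, if_neg hne]
    have hlt : PiNat.firstDiff x x' < κ K := by
      by_contra! hle
      exact h (funext fun i => PiNat.apply_eq_of_lt_firstDiff (i.2.trans_le hle))
    exact (hanti hlt.le).trans (le_mul_of_one_le_left (hρ0 _) (one_le_pow₀ hC))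
  · intro K
    exact (hpos _).trans (mul_le_mul_of_nonneg_left (hanti (hb K)) (by positivity))

/-- The boundary of a homogeneous tree is a sequence space. -/
theorem lipEquiv_boundary {V : Type*} {T : SimpleGraph V} {r : V} {c : ℕ → ℕ}
    (hT : IsHomogeneousTree T r c) {ξ : ℝ} (h0 : 0 < ξ) (h1 : ξ ≤ 1) :
    LipEquiv (boundaryDist T r ξ)
      (prefixDist ξ : (∀ k, Fin (c (k + 1))) → _ → ℝ) := by
  have hlev : ∀ (b : Boundary T r) k, T.dist r (b.1 k) = k := by
    intro b k
    induction k with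
    | zero => rw [b.2.1, SimpleGraph.dist_self]
    | succ k ih => rw [(b.2.2 k).2, ih]
  rw [prefixDist_eq_levelDist]
  have hinv : 1 ≤ ξ⁻¹ := (one_le_inv₀ h0).2 h1
  have hanti : Antitone fun k : ℕ => ξ ^ k := fun i j hij => pow_le_pow_of_le_one h0.le h1 hij
  have hext : ∀ b b' : Boundary T r, (fun k => b.1 (k + 1)) = (fun k => b'.1 (k + 1)) → b = b' := by
    intro b b' h
    refine Subtype.ext (funext fun k => ?_)
    cases k with
    | zero => rw [b.2.1, b'.2.1]
    | succ k => exact congrFun h k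
  refine lipEquiv_levelDist (C := ξ⁻¹) (V := fun K => {v : V // T.dist r v = K})
    (fun K v => {w | w.1 ∈ offspring T r v.1}) ?_ ⟨r, SimpleGraph.dist_self⟩
    (fun b K => ⟨b.1 K, hlev b K⟩) (fun b => Subtype.ext b.2.1) (fun b K => b.2.2 K) ?_ ?_ ?_
    hinv ?_ ?_ (fun K => by positivity) ?_
  · intro K v
    have h := hT.2 v.1
    rw [v.2] at h
    rw [← h]
    have hinj := Subtype.val_injective (p := fun v : V => T.dist r v = K + 1)
    rw [← hinj.encard_image]
    congr 1
    ext w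
    constructor
    · rintro ⟨w, hw, rfl⟩
      exact hw
    · intro hw
      exact ⟨⟨w, by rw [hw.2, v.2]⟩, hw, rfl⟩
  · intro v hv0 hv
    exact ⟨⟨fun K => (v K).1, congrArg Subtype.val hv0, hv⟩, rfl⟩
  · intro b b' h
    exact Subtype.ext (funext fun k => congrArg Subtype.val (congrFun h k))
  · intro b
    simp [boundaryDist, prefixDist]
  · intro b b' K hne h
    have hne' := fun h => hne (hext b b' h)
    rw [boundaryDist, prefixDist, if_neg hne']
    have hle : K ≤ PiNat.firstDiff (fun k => b.1 (k + 1)) (fun k => b'.1 (k + 1)) := by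
      by_contra! hlt
      exact PiNat.apply_firstDiff_ne hne' (congrArg Subtype.val (h _ hlt))
    exact (hanti hle).trans (le_mul_of_one_le_left (by positivity) hinv)
  · intro b b' K h
    have hne' : (fun k => b.1 (k + 1)) ≠ (fun k => b'.1 (k + 1)) := fun h' =>
      h (by rw [hext b b' h'])
    rw [boundaryDist, prefixDist, if_neg hne']
    have hlt : PiNat.firstDiff (fun k => b.1 (k + 1)) (fun k => b'.1 (k + 1)) ≤ K := by
      by_contra! hlt
      cases K with
      | zero => exact h (Subtype.ext (b.2.1.trans b'.2.1.symm))
      | succ K =>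
        have h' := PiNat.apply_eq_of_lt_firstDiff ((Nat.lt_succ_self K).trans hlt)
        exact h (Subtype.ext h')
    exact (hanti hlt).trans (le_mul_of_one_le_left (by positivity) hinv)
  · intro K
    rw [pow_succ']
    field_simp
    exact le_rfl

/-! ### Nested clusters in a complete metric space -/

open Filter Topology in
/-- Suppose the points of a complete space `X` are coded (by the relation `R`) by the elements of
`W`, each code passes through a cell of every level, and the cells of each level are labelled so
that, at the level `K`, points in cells with equal labels are at distance `≲ ρ K` and points in
cells with distinct labels are at distance `≳ ρ K`. If the cells can be given new parents that
depend only on the label, have the same label as the true parent, and leave every cell of level `K`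
with `c K` children, then `X` is a sequence space.

A point is mapped to the path `K ↦ par K (cell of level K + 1)`, whose `K`-th vertex tells only
the label of the point at level `K`, and is told by its label at level `K + 1`. -/
theorem lipEquiv_of_clusters {X W : Type*} [MetricSpace X] [CompleteSpace X] {R : X → W → Prop}
    (hRl : ∀ x, ∃ w, R x w) (hRr : ∀ w, ∃ x, R x w) {Cell Lab : ℕ → Type*}
    (cell : W → ∀ K, Cell K) (hcell : ∀ K v, ∃ w, cell w K = v) {v₀ : Cell 0}
    (hv₀ : ∀ v, v = v₀) (lab : ∀ K, Cell K → Lab K) (par : ∀ K, Cell (K + 1) → Cell K)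
    (hpar : ∀ K w, lab K (par K (cell w (K + 1))) = lab K (cell w K))
    (hconst : ∀ K v v', lab (K + 1) v = lab (K + 1) v' → par K v = par K v')
    {c : ℕ → ℕ} (hcard : ∀ K v, {u | par K u = v}.encard = c K) {C : ℝ} (hC : 1 ≤ C) {ρ : ℕ → ℝ}
    (hsame : ∀ x x' w w' K, R x w → R x' w' → lab K (cell w K) = lab K (cell w' K) →
      dist x x' ≤ C * ρ K)
    (hdiff : ∀ x x' w w' K, R x w → R x' w' → lab K (cell w K) ≠ lab K (cell w' K) →
      ρ K ≤ C * dist x x')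
    (hρ0 : ∀ K, 0 < ρ K) (hρ : ∀ K, ρ K ≤ C * ρ (K + 1)) (hlim : Tendsto ρ atTop (𝓝 0)) :
    LipEquiv (fun x x' : X => dist x x') (levelDist ρ : (∀ K, Fin (c K)) → _ → ℝ) := by
  choose sec hsec using hRl
  choose pt hpt using hRr
  have hClim : Tendsto (fun K => C * ρ K) atTop (𝓝 0) := by simpa using hlim.const_mul C
  have hagree : ∀ x x' K, par K (cell (sec x) (K + 1)) = par K (cell (sec x') (K + 1)) →
      dist x x' ≤ C * ρ K := fun x x' K h =>
    hsame x x' _ _ K (hsec x) (hsec x') (by rw [← hpar, ← hpar, h])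
  refine lipEquiv_levelDist (C := C * C) (V := Cell) (fun K v => {u | par K u = v}) hcard v₀
    (fun x K => par K (cell (sec x) (K + 1))) (fun x => hv₀ _)
    (fun x K => hconst _ _ _ (hpar _ _)) ?_ ?_ (fun x => dist_self x)
    (by nlinarith) ?_ ?_ (fun K => (hρ0 K).le) ?_
  · intro v _ hv
    choose w hw using fun K => hcell K (v K)
    have hlab : ∀ K L, K ≤ L → lab K (cell (w L) K) = lab K (v K) := by
      intro K L hKL
      obtain ⟨d, rfl⟩ := Nat.exists_eq_add_of_le hKL
      clear hKL
      induction d generalizing K with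
      | zero => rw [Nat.add_zero, hw]
      | succ d ih =>
        have h := hconst _ _ _ (ih (K + 1))
        rw [hv K, Nat.add_right_comm K 1 d] at h
        rw [← Nat.add_assoc, ← hpar, h]
    have hcau : CauchySeq fun K => pt (w K) := by
      refine cauchySeq_of_le_tendsto_0 (fun K => C * ρ K) (fun L L' K hL hL' => ?_) hClim
      exact hsame _ _ _ _ K (hpt _) (hpt _) (by rw [hlab K L hL, hlab K L' hL'])
    obtain ⟨x, hx⟩ := cauchySeq_tendsto_of_complete hcau
    refine ⟨x, funext fun K => ?_⟩
    rw [← hv K]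
    apply hconst
    by_contra hne
    have h0 : Tendsto (fun L => C * dist x (pt (w L))) atTop (𝓝 0) := by
      have h := (tendsto_const_nhds (x := x)).dist hx
      rw [dist_self] at h
      simpa using h.const_mul C
    refine absurd (ge_of_tendsto h0 ?_) (not_le.2 (hρ0 (K + 1)))
    filter_upwards [eventually_ge_atTop (K + 1)] with L hL
    exact hdiff _ _ _ _ (K + 1) (hsec x) (hpt _) (by rwa [hlab _ L hL])
  · intro x x' h
    exact dist_le_zero.1 (ge_of_tendsto' hClim fun K => hagree x x' K (congrFun h K))
  · intro x x' K _ h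
    refine (hagree x x' K (h K le_rfl)).trans ?_
    exact mul_le_mul_of_nonneg_right (by nlinarith) (hρ0 K).le
  · intro x x' K h
    rw [mul_assoc]
    exact (hρ K).trans (mul_le_mul_of_nonneg_left
      (hdiff _ _ _ _ (K + 1) (hsec x) (hsec x') fun h' => h (hconst _ _ _ h')) (by linarith))
  · intro K
    exact (hρ K).trans (mul_le_mul_of_nonneg_right (by nlinarith) (hρ0 _).le)

/-! ### Words as integers, cuts and cyclic ranks -/

/-- The integers `B * u + l` with `u ∈ U` and `l ∈ L`: if `L ⊆ {0, …, B - 1}`, words of `U` followed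
by words of `L`, where a word over `{0, …, b - 1}` is read as an integer in base `b`. -/
def glue (B : ℕ) (U L : Finset ℕ) : Finset ℕ :=
  (U ×ˢ L).image fun p => B * p.1 + p.2

theorem mem_glue {B : ℕ} {U L : Finset ℕ} (hL : ∀ l ∈ L, l < B) {y : ℕ} :
    y ∈ glue B U L ↔ y / B ∈ U ∧ y % B ∈ L := by
  simp only [glue, Finset.mem_image, Finset.mem_product, Prod.exists]
  constructor
  · rintro ⟨u, l, ⟨hu, hl⟩, rfl⟩
    have hlB := hL l hl
    rw [Nat.mul_add_div (by omega), Nat.div_eq_of_lt hlB, Nat.mul_add_mod, Nat.mod_eq_of_lt hlB]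
    exact ⟨hu, hl⟩
  · intro h
    exact ⟨_, _, h, Nat.div_add_mod y B⟩

theorem card_glue {B : ℕ} {U L : Finset ℕ} (hL : ∀ l ∈ L, l < B) :
    (glue B U L).card = U.card * L.card := by
  rw [glue, Finset.card_image_of_injOn, Finset.card_product]
  rintro ⟨u, l⟩ h ⟨u', l'⟩ h' heq
  simp only [Finset.coe_product, Set.mem_prod, Finset.mem_coe] at h h'
  have hl := hL l h.2
  have hl' := hL l' h'.2
  simp only at heq
  have h1 : (B * u + l) / B = u := by
    rw [Nat.mul_add_div (by omega), Nat.div_eq_of_lt hl, Nat.add_zero]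
  have h2 : (B * u' + l') / B = u' := by
    rw [Nat.mul_add_div (by omega), Nat.div_eq_of_lt hl', Nat.add_zero]
  have h3 : u = u' := by rw [← h1, heq, h2]
  subst h3
  simpa using heq

/-- The number of points `q * B + g` with `q ≥ 0` that are smaller than `y`. When the residue `g` is
vacant, these points are gaps, and `cut B g` numbers the intervals between consecutive gaps. -/
def cut (B g y : ℕ) : ℕ := (y + (B - 1 - g)) / B

theorem cut_le_iff {B g y q : ℕ} (hg : g < B) : cut B g y ≤ q ↔ y ≤ q * B + g := by
  rw [cut, Nat.div_le_iff_le_mul_add_pred (by omega), mul_comm]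
  omega

theorem add_two_le_of_cut_lt {B g y y' : ℕ} (hg : g < B) (h : cut B g y < cut B g y')
    (hy : y % B ≠ g) : y + 2 ≤ y' := by
  have h1 := (cut_le_iff hg).1 (le_refl (cut B g y))
  have h2 := mt (cut_le_iff hg).2 (not_le.2 h)
  have h3 : y ≠ cut B g y * B + g := fun h' => hy (by
    rw [h', Nat.mul_add_mod_self_right, Nat.mod_eq_of_lt hg])
  omega

theorem lt_add_of_cut_eq {B g y y' : ℕ} (hg : g < B) (h : cut B g y = cut B g y') :
    y' < y + B := by
  have h1 := (cut_le_iff hg).1 h.symm.le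
  by_contra! hlt
  have h2 : cut B g y' ≤ cut B g y := h.symm.le
  rcases Nat.eq_zero_or_pos (cut B g y) with h0 | h0
  · rw [h0] at h1
    omega
  · obtain ⟨q, hq⟩ := Nat.exists_eq_add_of_le' h0
    have h3 : ¬ cut B g y ≤ q := by omega
    rw [cut_le_iff hg] at h3
    rw [hq, add_mul] at h1
    omega

theorem cut_mono {B g y y' : ℕ} (h : y ≤ y') : cut B g y ≤ cut B g y' :=
  Nat.div_le_div_right (by omega)

theorem cut_eq_of_le_succ {B g y y' : ℕ} (hg : g < B) (h : y ≤ y') (h' : y' ≤ y + 1)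
    (hy : y % B ≠ g) : cut B g y = cut B g y' := by
  by_contra hne
  have := add_two_le_of_cut_lt hg (lt_of_le_of_ne (cut_mono h) hne) hy
  omega

theorem cut_eq_div {B g y : ℕ} (h : y % B < g) (hg : g < B) : cut B g y = y / B := by
  have h1 := Nat.div_add_mod y B
  rw [mul_comm] at h1
  apply le_antisymm
  · rw [cut_le_iff hg]
    omega
  · exact Nat.div_le_div_right (by omega)

theorem cut_eq_div_add_one {B g y : ℕ} (h : g < y % B) (hg : g < B) :
    cut B g y = y / B + 1 := by
  have h2 := Nat.mod_lt y (by omega : 0 < B)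
  have h1 := Nat.div_add_mod y B
  rw [mul_comm] at h1
  apply le_antisymm
  · rw [cut_le_iff (by omega), add_mul]
    omega
  · by_contra! hlt
    have := (cut_le_iff (B := B) (by omega)).1 (Nat.lt_succ_iff.1 hlt)
    omega

theorem div_le_cut (B g y : ℕ) : y / B ≤ cut B g y := Nat.div_le_div_right (by omega)

theorem cut_le_div_add_one {B g : ℕ} (hg : g < B) (y : ℕ) : cut B g y ≤ y / B + 1 := by
  have h2 := Nat.mod_lt y (by omega : 0 < B)
  have h1 := Nat.div_add_mod y B
  rw [mul_comm] at h1
  rw [cut_le_iff hg, add_mul]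
  omega

/-- Integers in the same interval of a cut have initial words that are equal or consecutive; hence
the initial words are in the same interval of any cut at a vacant residue. -/
theorem cut_div_eq {B g B' g' c y y' : ℕ} (hg : g < B) (hg' : g' < B')
    (h : cut B g y = cut B g y') (hy : y / (B * c) % B' ≠ g') (hy' : y' / (B * c) % B' ≠ g') :
    cut B' g' (y / (B * c)) = cut B' g' (y' / (B * c)) := by
  wlog hle : y ≤ y' generalizing y y'
  · exact (this h.symm hy' hy (le_of_not_ge hle)).symm
  refine cut_eq_of_le_succ hg' (Nat.div_le_div_right hle) ?_ hy
  have h1 := lt_add_of_cut_eq hg h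
  rcases Nat.eq_zero_or_pos c with rfl | hc
  · simp
  · rw [← Nat.add_div_right _ (Nat.mul_pos (by omega) hc)]
    refine Nat.div_le_div_right ?_
    nlinarith

/-- The rank of `v` in the finite set `U`, taken cyclically: beyond all elements of `U` it is `0`
again. -/
def cycRank (U : Finset ℕ) (v : ℕ) : ℕ := (U.filter (· < v)).card % U.card

theorem cycRank_lt {U : Finset ℕ} (hU : U.Nonempty) (v : ℕ) : cycRank U v < U.card :=
  Nat.mod_lt _ hU.card_pos

theorem cycRank_eq_zero_of_forall_lt {U : Finset ℕ} {v : ℕ} (h : ∀ u ∈ U, u < v) :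
    cycRank U v = 0 := by
  rw [cycRank, Finset.filter_true_of_mem h, Nat.mod_self]

theorem cycRank_eq_zero_of_forall_le {U : Finset ℕ} {v : ℕ} (h : ∀ u ∈ U, v ≤ u) :
    cycRank U v = 0 := by
  rw [cycRank, Finset.filter_false_of_mem fun u hu => not_lt.2 (h u hu), Finset.card_empty,
    Nat.zero_mod]

theorem card_filter_cycRank_eq_one {U : Finset ℕ} {e i : ℕ} (he : e ≤ 1) (hi : i < U.card) :
    (U.filter fun u => cycRank U (u + e) = i).card = 1 := by
  have hU : U.Nonempty := Finset.card_pos.1 (by omega)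
  have hr : ∀ u ∈ U, (U.filter (· < u + e)).card = (U.filter (· < u)).card + e := by
    intro u hu
    obtain rfl | rfl : e = 0 ∨ e = 1 := by omega
    · rfl
    · have : U.filter (· < u + 1) = insert u (U.filter (· < u)) := by
        ext x
        simp only [Finset.mem_filter, Finset.mem_insert]
        constructor
        · rintro ⟨h1, h2⟩
          rcases Nat.lt_succ_iff_lt_or_eq.1 h2 with h | h
          · exact Or.inr ⟨h1, h⟩
          · exact Or.inl h
        · rintro (rfl | h)
          · exact ⟨hu, Nat.lt_succ_self _⟩
          · exact ⟨h.1, by omega⟩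
      rw [this, Finset.card_insert_of_notMem (by simp)]
  have hlt : ∀ u ∈ U, (U.filter (· < u)).card < U.card := fun u hu =>
    Finset.card_lt_card (Finset.filter_ssubset.2 ⟨u, hu, lt_irrefl _⟩)
  have hstrict : ∀ u ∈ U, ∀ u' ∈ U, u < u' →
      (U.filter (· < u)).card < (U.filter (· < u')).card := by
    intro u hu u' _ h
    refine Finset.card_lt_card (Finset.ssubset_iff_of_subset ?_ |>.2 ⟨u, ?_, ?_⟩)
    · intro x hx
      rw [Finset.mem_filter] at hx ⊢
      exact ⟨hx.1, hx.2.trans h⟩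
    · exact Finset.mem_filter.2 ⟨hu, h⟩
    · simp
  have hinj : Set.InjOn (fun u => cycRank U (u + e)) (U : Set ℕ) := by
    intro u hu u' hu' h
    simp only [cycRank, hr u hu, hr u' hu'] at h
    have h1 : (U.filter (· < u)).card ≡ (U.filter (· < u')).card [MOD U.card] :=
      Nat.ModEq.add_right_cancel' e h
    have h2 := Nat.ModEq.eq_of_lt_of_lt h1 (hlt u hu) (hlt u' hu')
    rcases lt_trichotomy u u' with h' | h' | h'
    · exact absurd h2 (hstrict u hu u' hu' h').ne
    · exact h'
    · exact absurd h2 (hstrict u' hu' u hu h').ne'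
  have hmaps : Set.MapsTo (fun u => cycRank U (u + e)) (U : Set ℕ) (Finset.range U.card) :=
    fun u _ => Finset.mem_coe.2 (Finset.mem_range.2 (cycRank_lt hU _))
  obtain ⟨u, hu, hui⟩ := Finset.surjOn_of_injOn_of_card_le _ hmaps hinj (by simp)
    (Finset.mem_coe.2 (Finset.mem_range.2 hi))
  rw [Finset.card_eq_one]
  refine ⟨u, ?_⟩
  ext x
  rw [Finset.mem_filter, Finset.mem_singleton]
  constructor
  · rintro ⟨hx, hxi⟩
    exact hinj hx hu (hxi.trans hui.symm)
  · rintro rfl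
    exact ⟨hu, hui⟩

/-- Cutting at a vacant residue `g` and joining the two end intervals cyclically distributes the
words of `glue B U L` equally: the part of a block above its cut and the part of the next block
below its cut have `#L` elements together. -/
theorem card_filter_cycRank_cut {B g i : ℕ} {U L : Finset ℕ} (hL : ∀ l ∈ L, l < B) (hg : g < B)
    (hgL : g ∉ L) (hi : i < U.card) :
    ((glue B U L).filter fun y => cycRank U (cut B g y) = i).card = L.card := by
  rw [Finset.card_eq_sum_card_fiberwise (f := fun y => y % B) (t := L)]
  swap
  · intro y hy
    exact ((mem_glue hL).1 (Finset.mem_filter.1 hy).1).2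
  rw [Finset.card_eq_sum_ones]
  refine Finset.sum_congr rfl fun l hl => ?_
  have hlB := hL l hl
  obtain ⟨e, he, hcut⟩ : ∃ e ≤ 1, ∀ u, cut B g (B * u + l) = u + e := by
    rcases lt_or_gt_of_ne (fun h : l = g => hgL (h ▸ hl)) with h | h
    · refine ⟨0, by omega, fun u => ?_⟩
      rw [cut_eq_div (by rwa [Nat.mul_add_mod, Nat.mod_eq_of_lt hlB]) hg,
        Nat.mul_add_div (by omega), Nat.div_eq_of_lt hlB]
    · refine ⟨1, le_rfl, fun u => ?_⟩
      rw [cut_eq_div_add_one (by rwa [Nat.mul_add_mod, Nat.mod_eq_of_lt hlB]) hg,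
        Nat.mul_add_div (by omega), Nat.div_eq_of_lt hlB, Nat.add_zero]
  rw [← card_filter_cycRank_eq_one he hi]
  symm
  refine Finset.card_bij (fun u _ => B * u + l) ?_ ?_ ?_
  · intro u hu
    rw [Finset.mem_filter] at hu
    rw [Finset.mem_filter, Finset.mem_filter, mem_glue hL, Nat.mul_add_mod, Nat.mod_eq_of_lt hlB,
      Nat.mul_add_div (by omega), Nat.div_eq_of_lt hlB, hcut]
    exact ⟨⟨⟨hu.1, hl⟩, hu.2⟩, rfl⟩
  · intro u _ u' _ h
    exact Nat.eq_of_mul_eq_mul_left (by omega : 0 < B) (Nat.add_right_cancel h)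
  · intro y hy
    rw [Finset.mem_filter, Finset.mem_filter, mem_glue hL] at hy
    have hy' := Nat.div_add_mod y B
    rw [hy.2] at hy'
    refine ⟨y / B, Finset.mem_filter.2 ⟨hy.1.1.1, ?_⟩, hy'⟩
    rw [← hcut, hy']
    exact hy.1.2

/-- The planar version of `card_filter_cycRank_cut`. The cuts of the first coordinate may depend on
the interval `cut m v₀ p.2` of the second coordinate. -/
theorem card_filter_cycRank_cut_prod {B m v₀ i j : ℕ} {U L W J : Finset ℕ} {g : ℕ → ℕ}
    (hL : ∀ l ∈ L, l < B) (hJ : ∀ l ∈ J, l < m) (hv : v₀ < m) (hvJ : v₀ ∉ J)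
    (hg : ∀ y ∈ glue m W J, g (cut m v₀ y) < B ∧ g (cut m v₀ y) ∉ L)
    (hi : i < U.card) (hj : j < W.card) :
    ((glue B U L ×ˢ glue m W J).filter fun p =>
      cycRank U (cut B (g (cut m v₀ p.2)) p.1) = i ∧ cycRank W (cut m v₀ p.2) = j).card =
      L.card * J.card := by
  rw [Finset.card_eq_sum_card_fiberwise (f := Prod.snd)
    (t := (glue m W J).filter fun y => cycRank W (cut m v₀ y) = j)]
  swap
  · rintro ⟨x, y⟩ h
    simp only [Finset.coe_filter, Set.mem_ofPred_eq, Finset.mem_product] at h ⊢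
    exact ⟨h.1.2, h.2.2⟩
  rw [← card_filter_cycRank_cut (U := W) hJ hv hvJ hj, mul_comm, ← smul_eq_mul,
    ← Finset.sum_const]
  refine Finset.sum_congr rfl fun y hy => ?_
  rw [Finset.mem_filter] at hy
  obtain ⟨h1, h2⟩ := hg y hy.1
  rw [← card_filter_cycRank_cut (U := U) hL h1 h2 hi]
  symm
  refine Finset.card_bij (fun x _ => (x, y)) ?_ ?_ ?_
  · intro x hx
    rw [Finset.mem_filter] at hx
    rw [Finset.mem_filter, Finset.mem_filter, Finset.mem_product]
    exact ⟨⟨⟨hx.1, hy.1⟩, hx.2, hy.2⟩, rfl⟩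
  · intro x _ x' _ h
    exact congrArg Prod.fst h
  · rintro ⟨x, y'⟩ h
    simp only [Finset.mem_filter, Finset.mem_product] at h
    obtain ⟨⟨⟨hx, _⟩, hx', _⟩, rfl⟩ := h
    exact ⟨x, Finset.mem_filter.2 ⟨hx, hx'⟩, rfl⟩

/-! ### Equal distribution -/

theorem exists_equal_fibers {ι α : Type*} [DecidableEq ι] [DecidableEq α] {A : Finset α} {M : ℕ}
    (hA : A.Nonempty) (I : Finset ι) (hI : I.card = A.card * M) :
    ∃ f : ι → α, (∀ i, f i ∈ A) ∧ ∀ a ∈ A, (I.filter fun i => f i = a).card = M := by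
  induction hA using Finset.Nonempty.cons_induction generalizing I with
  | singleton a =>
    refine ⟨fun _ => a, fun _ => Finset.mem_singleton_self a, fun b hb => ?_⟩
    rw [Finset.mem_singleton] at hb
    subst hb
    simpa using hI
  | cons a A ha hA ih =>
    rw [Finset.card_cons, add_mul, one_mul] at hI
    obtain ⟨S, hSI, hS⟩ := Finset.exists_subset_card_eq (show M ≤ I.card by omega)
    obtain ⟨f, hf, hf'⟩ := ih (I \ S) (by rw [Finset.card_sdiff_of_subset hSI]; omega)
    refine ⟨fun i => if i ∈ S then a else f i, fun i => ?_, fun b hb => ?_⟩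
    · dsimp only
      split_ifs
      · exact Finset.mem_cons_self a A
      · exact Finset.mem_cons_of_mem (hf i)
    · rw [Finset.mem_cons] at hb
      by_cases hba : b = a
      · subst hba
        rw [← hS]
        congr 1
        ext i
        rw [Finset.mem_filter]
        constructor
        · rintro ⟨_, h⟩
          by_contra hi
          simp only [if_neg hi] at h
          exact ha (h ▸ hf i)
        · intro hi
          exact ⟨hSI hi, if_pos hi⟩
      · rw [← hf' b (hb.resolve_left hba)]
        congr 1
        ext i
        rw [Finset.mem_filter, Finset.mem_filter, Finset.mem_sdiff]
        by_cases hi : i ∈ S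
        · simp [hi, Ne.symm hba]
        · simp [hi]

/-- Items can be distributed equally with prescribed few of them going to the same place. -/
theorem exists_equal_fibers_const_on {ι α : Type*} [DecidableEq ι] [DecidableEq α] {A : Finset α}
    {M : ℕ} (hA : A.Nonempty) {I S : Finset ι} (hI : I.card = A.card * M) (hSI : S ⊆ I)
    (hS : S.card ≤ M) :
    ∃ f : ι → α, (∀ i, f i ∈ A) ∧ (∀ a ∈ A, (I.filter fun i => f i = a).card = M) ∧
      ∀ i ∈ S, ∀ j ∈ S, f i = f j := by
  obtain ⟨a, ha⟩ := hA
  have hApos : 1 ≤ A.card := Finset.card_pos.2 ⟨a, ha⟩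
  obtain ⟨S', hSS', hS'I, hS'⟩ := Finset.exists_subsuperset_card_eq hSI hS
    (by rw [hI]; exact Nat.le_mul_of_pos_left M hApos)
  have key : ∃ f : ι → α, (∀ i, f i ∈ A) ∧ ∀ b ∈ A,
      ((I \ S').filter fun i => f i = b).card = if b = a then 0 else M := by
    rcases (A.erase a).eq_empty_or_nonempty with h | h
    · have hA1 : A = {a} := by
        rw [← Finset.insert_erase ha, h]
        rfl
      refine ⟨fun _ => a, fun _ => ha, fun b hb => ?_⟩
      rw [hA1, Finset.mem_singleton] at hb
      rw [if_pos hb]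
      rw [hA1, Finset.card_singleton, one_mul] at hI
      have : I \ S' = ∅ := by
        rw [← Finset.card_eq_zero, Finset.card_sdiff_of_subset hS'I, hI, hS', Nat.sub_self]
      rw [this]
      rfl
    · obtain ⟨f, hf, hf'⟩ := exists_equal_fibers (M := M) h (I \ S') (by
        rw [Finset.card_sdiff_of_subset hS'I, Finset.card_erase_of_mem ha, hI, hS', Nat.sub_mul,
          one_mul])
      refine ⟨f, fun i => Finset.mem_of_mem_erase (hf i), fun b hb => ?_⟩
      split_ifs with hba
      · rw [Finset.card_eq_zero, Finset.filter_eq_empty_iff]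
        intro i _ hi
        exact Finset.ne_of_mem_erase (hf i) (hi.trans hba)
      · exact hf' b (Finset.mem_erase.2 ⟨hba, hb⟩)
  obtain ⟨f, hf, hf'⟩ := key
  refine ⟨fun i => if i ∈ S' then a else f i, fun i => ?_, fun b hb => ?_, fun i hi j hj => ?_⟩
  · dsimp only
    split_ifs
    · exact ha
    · exact hf i
  · have hsplit : (I.filter fun i => (if i ∈ S' then a else f i) = b) =
        (S'.filter fun _ => a = b) ∪ (I \ S').filter fun i => f i = b := by
      ext i
      simp only [Finset.mem_filter, Finset.mem_union, Finset.mem_sdiff]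
      by_cases hi : i ∈ S'
      · simp [hi, hS'I hi]
      · simp [hi]
    rw [hsplit, Finset.card_union_of_disjoint, hf' b hb]
    · by_cases hba : b = a
      · simp [hba, hS']
      · simp [hba, Ne.symm hba]
    · refine Finset.disjoint_left.2 fun i hi hi' => ?_
      exact (Finset.mem_sdiff.1 (Finset.mem_filter.1 hi').1).2 (Finset.mem_filter.1 hi).1
  · simp only [if_pos (hSS' hi), if_pos (hSS' hj)]

/-! ### Digit systems and their cells -/

/-- A set of digits in base `(n, m)`: `R y` is the set of the first coordinates of the digits in the
row `y`, and `J` is the set of the nonvacant rows, all of which contain `a` digits. -/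
structure DigitSystem (n m a : ℕ) where
  /-- The digits of a row. -/
  R : ℕ → Finset ℕ
  /-- The nonvacant rows. -/
  J : Finset ℕ
  R_lt : ∀ y, ∀ x ∈ R y, x < n
  J_lt : ∀ y ∈ J, y < m
  card_R : ∀ y ∈ J, (R y).card = a
  R_eq_empty : ∀ y ∉ J, R y = ∅

namespace DigitSystem

variable {n m a : ℕ} (S : DigitSystem n m a)

/-- The words of length `l` over the nonvacant rows, read as integers in base `m`. -/
def rowSet : ℕ → Finset ℕ
  | 0 => {0}
  | l + 1 => glue m (rowSet l) S.J

/-- The words of length `k` of first coordinates, read as integers in base `n`, that go with the row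
word formed by the last `k` digits of `y` in base `m`. -/
def colSet : ℕ → ℕ → Finset ℕ
  | 0, _ => {0}
  | k + 1, y => glue n (colSet k (y / m)) (S.R (y % m))

theorem mem_rowSet_succ {l y : ℕ} : y ∈ S.rowSet (l + 1) ↔ y / m ∈ S.rowSet l ∧ y % m ∈ S.J :=
  mem_glue S.J_lt

theorem mem_colSet_succ {k x y : ℕ} :
    x ∈ S.colSet (k + 1) y ↔ x / n ∈ S.colSet k (y / m) ∧ x % n ∈ S.R (y % m) :=
  mem_glue (S.R_lt _)

theorem mem_rowSet_add {l r y : ℕ} :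
    y ∈ S.rowSet (l + r) ↔ y / m ^ r ∈ S.rowSet l ∧ y % m ^ r ∈ S.rowSet r := by
  induction r generalizing y with
  | zero => simp [rowSet, Nat.mod_one]
  | succ r ih =>
    rw [← Nat.add_assoc, mem_rowSet_succ, ih, mem_rowSet_succ, pow_succ', Nat.div_div_eq_div_mul,
      Nat.mod_mul_right_div_self, Nat.mod_mul_right_mod, and_assoc]

theorem mem_colSet_add {k t x y : ℕ} :
    x ∈ S.colSet (k + t) y ↔ x / n ^ t ∈ S.colSet k (y / m ^ t) ∧ x % n ^ t ∈ S.colSet t y := by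
  induction t generalizing x y with
  | zero => simp [colSet, Nat.mod_one]
  | succ t ih =>
    rw [← Nat.add_assoc, mem_colSet_succ, ih, mem_colSet_succ, pow_succ', pow_succ',
      Nat.div_div_eq_div_mul, Nat.div_div_eq_div_mul, Nat.mod_mul_right_div_self,
      Nat.mod_mul_right_mod, and_assoc]

theorem lt_of_mem_rowSet {l y : ℕ} (h : y ∈ S.rowSet l) : y < m ^ l := by
  induction l generalizing y with
  | zero => simpa [rowSet] using h
  | succ l ih =>
    rw [mem_rowSet_succ] at h
    have hm : 0 < m := (Nat.zero_le _).trans_lt (S.J_lt _ h.2)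
    rw [pow_succ]
    exact (Nat.div_lt_iff_lt_mul hm).1 (ih h.1)

theorem lt_of_mem_colSet {k x y : ℕ} (h : x ∈ S.colSet k y) : x < n ^ k := by
  induction k generalizing x y with
  | zero => simpa [colSet] using h
  | succ k ih =>
    rw [mem_colSet_succ] at h
    have hn : 0 < n := (Nat.zero_le _).trans_lt (S.R_lt _ _ h.2)
    rw [pow_succ]
    exact (Nat.div_lt_iff_lt_mul hn).1 (ih h.1)

theorem card_rowSet (l : ℕ) : (S.rowSet l).card = S.J.card ^ l := by
  induction l with
  | zero => rfl
  | succ l ih => rw [rowSet, card_glue S.J_lt, ih, pow_succ]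

theorem card_colSet_le (k y : ℕ) : (S.colSet k y).card ≤ a ^ k := by
  induction k generalizing y with
  | zero => simp [colSet]
  | succ k ih =>
    rw [colSet, card_glue (S.R_lt _), pow_succ]
    refine Nat.mul_le_mul (ih _) ?_
    by_cases h : y % m ∈ S.J
    · exact (S.card_R _ h).le
    · simp [S.R_eq_empty _ h]

theorem card_colSet {k l y : ℕ} (hkl : k ≤ l) (hy : y ∈ S.rowSet l) :
    (S.colSet k y).card = a ^ k := by
  induction k generalizing l y with
  | zero => simp [colSet]
  | succ k ih =>
    obtain ⟨l, rfl⟩ : ∃ l', l = l' + 1 := ⟨l - 1, by omega⟩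
    rw [mem_rowSet_succ] at hy
    rw [colSet, card_glue (S.R_lt _), pow_succ, ih (by omega) hy.1, S.card_R _ hy.2]

theorem div_mem_rowSet {l r y : ℕ} (h : y ∈ S.rowSet (l + r)) : y / m ^ r ∈ S.rowSet l :=
  (S.mem_rowSet_add.1 h).1

/-- The approximate squares with `k` digits and, for `k ≤ l`, `l - k` further rows. The approximate
square with the base `n` expansion `X` and the base `m` expansion `Y` of its first and second
coordinates is represented by the pair `(X, Y)`. -/
def cells (k l : ℕ) : Finset (ℕ × ℕ) :=
  (S.rowSet l).biUnion fun y => (S.colSet k (y / m ^ (l - k))).image fun x => (x, y)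

theorem mem_cells {k l : ℕ} {p : ℕ × ℕ} :
    p ∈ S.cells k l ↔ p.2 ∈ S.rowSet l ∧ p.1 ∈ S.colSet k (p.2 / m ^ (l - k)) := by
  obtain ⟨x, y⟩ := p
  simp only [cells, Finset.mem_biUnion, Finset.mem_image, Prod.mk.injEq]
  constructor
  · rintro ⟨y, hy, x, hx, rfl, rfl⟩
    exact ⟨hy, hx⟩
  · rintro ⟨hy, hx⟩
    exact ⟨y, hy, x, hx, rfl, rfl⟩

theorem card_cells {k l : ℕ} (hkl : k ≤ l) : (S.cells k l).card = a ^ k * S.J.card ^ l := by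
  rw [cells, Finset.card_biUnion, ← card_rowSet, mul_comm, ← smul_eq_mul, ← Finset.sum_const]
  · refine Finset.sum_congr rfl fun y hy => ?_
    rw [Finset.card_image_of_injective _ fun x x' h => congrArg Prod.fst h]
    obtain ⟨d, rfl⟩ := Nat.exists_eq_add_of_le hkl
    rw [Nat.add_sub_cancel_left]
    exact S.card_colSet le_rfl (S.div_mem_rowSet hy)
  · intro y _ y' _ hne
    refine Finset.disjoint_left.2 fun p hp hp' => hne ?_
    simp only [Finset.mem_image] at hp hp'
    obtain ⟨x, _, rfl⟩ := hp
    obtain ⟨x', _, h⟩ := hp'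
    exact (congrArg Prod.snd h).symm

theorem cells_zero : S.cells 0 0 = {(0, 0)} := by
  ext p
  rw [mem_cells, Finset.mem_singleton, rowSet, colSet, Finset.mem_singleton, Finset.mem_singleton,
    Prod.ext_iff, and_comm]

theorem div_mem_cells {k t l r : ℕ} (hl : k + t ≤ l) {p : ℕ × ℕ}
    (hp : p ∈ S.cells (k + t) (l + r)) : (p.1 / n ^ t, p.2 / m ^ r) ∈ S.cells k l := by
  rw [mem_cells] at hp ⊢
  refine ⟨S.div_mem_rowSet hp.1, ?_⟩
  have h := (S.mem_colSet_add.1 hp.2).1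
  rw [Nat.div_div_eq_div_mul, ← pow_add] at h ⊢
  rwa [show r + (l - k) = l + r - (k + t) + t by omega]

/-! ### Vacant words and labels of cells -/

/-- A word of length `t` that is vacant for both row words `y` and `y'`. -/
def gap (t y y' : ℕ) : ℕ :=
  open Classical in
  if h : ∃ g < n ^ t, g ∉ S.colSet t y ∪ S.colSet t y' then h.choose else 0

theorem gap_spec {t : ℕ} (ht : 2 * a ^ t < n ^ t) (y y' : ℕ) :
    S.gap t y y' < n ^ t ∧ S.gap t y y' ∉ S.colSet t y ∧ S.gap t y y' ∉ S.colSet t y' := by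
  have h : ∃ g < n ^ t, g ∉ S.colSet t y ∪ S.colSet t y' := by
    obtain ⟨g, hg, hg'⟩ := Finset.exists_mem_notMem_of_card_lt_card
      (s := S.colSet t y ∪ S.colSet t y') (t := Finset.range (n ^ t)) (by
        rw [Finset.card_range]
        have := Finset.card_union_le (S.colSet t y) (S.colSet t y')
        have := S.card_colSet_le t y
        have := S.card_colSet_le t y'
        omega)
    exact ⟨g, Finset.mem_range.1 hg, hg'⟩
  rw [gap, dif_pos h]
  have h' := h.choose_spec
  rw [Finset.mem_union, not_or] at h'
  exact h'

/-- The residue modulo `n ^ t₀` at which the columns are cut in the `z`-th horizontal slab of the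
cells of level `(k, l)`. The slab consists of the rows of the word `z - 1` above the vacant row and
of the rows of the word `z` below the vacant row. -/
def cutCol (t₀ k l z : ℕ) : ℕ :=
  S.gap t₀ ((z - 1) / m ^ (l - k - 1)) (z / m ^ (l - k - 1))

/-- The label of a cell of level `(k, l)`: the number of its slab between vertical gaps at the
vacant row `v₀`, and the number of its interval between horizontal gaps of this slab. -/
def label (v₀ t₀ k l : ℕ) (p : ℕ × ℕ) : ℕ × ℕ :=
  (cut m v₀ p.2, cut (n ^ t₀) (S.cutCol t₀ k l (cut m v₀ p.2)) p.1)

variable {S} {v₀ t₀ : ℕ}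

theorem mod_ne_of_mem_rowSet (hv : v₀ ∉ S.J) {l y : ℕ} (hl : 1 ≤ l) (hy : y ∈ S.rowSet l) :
    y % m ≠ v₀ := by
  obtain ⟨l, rfl⟩ : ∃ l', l = l' + 1 := ⟨l - 1, by omega⟩
  rintro rfl
  exact hv (S.mem_rowSet_succ.1 hy).2

theorem cutCol_lt (ht₀ : 2 * a ^ t₀ < n ^ t₀) (k l z : ℕ) : S.cutCol t₀ k l z < n ^ t₀ :=
  (S.gap_spec ht₀ _ _).1

theorem cutCol_notMem (hvm : v₀ < m) (hv : v₀ ∉ S.J) (ht₀ : 2 * a ^ t₀ < n ^ t₀) {k l y : ℕ}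
    (hkl : k + 1 ≤ l) (hy : y ∈ S.rowSet l) :
    S.cutCol t₀ k l (cut m v₀ y) ∉ S.colSet t₀ (y / m ^ (l - k)) := by
  have hne := mod_ne_of_mem_rowSet hv (by omega) hy
  have h1 : y / m ^ (l - k) = y / m / m ^ (l - k - 1) := by
    rw [Nat.div_div_eq_div_mul, ← pow_succ', show l - k - 1 + 1 = l - k by omega]
  obtain ⟨-, hg1, hg2⟩ := S.gap_spec ht₀ ((cut m v₀ y - 1) / m ^ (l - k - 1))
    (cut m v₀ y / m ^ (l - k - 1))
  rw [h1]
  rcases lt_or_gt_of_ne hne with h | h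
  · rw [cut_eq_div h hvm] at hg2 ⊢
    exact hg2
  · rw [cut_eq_div_add_one h hvm] at hg1 ⊢
    exact hg1

theorem mod_ne_cutCol (hvm : v₀ < m) (hv : v₀ ∉ S.J) (ht₀ : 2 * a ^ t₀ < n ^ t₀) {k l : ℕ}
    (hkl : k + 1 ≤ l) (hk : t₀ ≤ k) {p : ℕ × ℕ} (hp : p ∈ S.cells k l) :
    p.1 % n ^ t₀ ≠ S.cutCol t₀ k l (cut m v₀ p.2) := by
  rw [mem_cells] at hp
  intro h
  apply cutCol_notMem hvm hv ht₀ hkl hp.1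
  rw [← h]
  obtain ⟨d, rfl⟩ := Nat.exists_eq_add_of_le' hk
  exact (S.mem_colSet_add.1 hp.2).2

/-- Cells with equal labels have parents with equal labels. -/
theorem label_div_eq (hvm : v₀ < m) (hv : v₀ ∉ S.J) (ht₀ : 2 * a ^ t₀ < n ^ t₀) {k t l r : ℕ}
    (hk : t₀ ≤ k) (ht : t₀ ≤ t) (hr : 1 ≤ r) (hl : k + t + 1 ≤ l) {p p' : ℕ × ℕ}
    (hp : p ∈ S.cells (k + t) (l + r)) (hp' : p' ∈ S.cells (k + t) (l + r))
    (h : S.label v₀ t₀ (k + t) (l + r) p = S.label v₀ t₀ (k + t) (l + r) p') :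
    S.label v₀ t₀ k l (p.1 / n ^ t, p.2 / m ^ r) =
      S.label v₀ t₀ k l (p'.1 / n ^ t, p'.2 / m ^ r) := by
  have hq := S.div_mem_cells (by omega) hp
  have hq' := S.div_mem_cells (by omega) hp'
  have h1 : cut m v₀ p.2 = cut m v₀ p'.2 := congrArg Prod.fst h
  have h2 := congrArg Prod.snd h
  simp only [label] at h2
  rw [← h1] at h2
  have hz : cut m v₀ (p.2 / m ^ r) = cut m v₀ (p'.2 / m ^ r) := by
    have hmr : m ^ r = m * m ^ (r - 1) := by
      rw [← pow_succ', show r - 1 + 1 = r by omega]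
    have e1 := mod_ne_of_mem_rowSet hv (by omega) (S.mem_cells.1 hq).1
    have e2 := mod_ne_of_mem_rowSet hv (by omega) (S.mem_cells.1 hq').1
    simp only [hmr] at e1 e2 ⊢
    exact cut_div_eq hvm hvm h1 e1 e2
  have e1 := mod_ne_cutCol hvm hv ht₀ (by omega) hk hq
  have e2 := mod_ne_cutCol hvm hv ht₀ (by omega) hk hq'
  simp only [label]
  refine Prod.ext hz ?_
  simp only at e1 e2 ⊢
  rw [← hz] at e2 ⊢
  have hnt : n ^ t = n ^ t₀ * n ^ (t - t₀) := by
    rw [← pow_add, show t₀ + (t - t₀) = t by omega]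
  rw [hnt] at e1 e2 ⊢
  exact cut_div_eq (cutCol_lt ht₀ _ _ _) (cutCol_lt ht₀ _ _ _) h2 e1 e2

end DigitSystem

namespace DigitSystem

variable {n m a : ℕ} {S : DigitSystem n m a} {v₀ t₀ : ℕ}

/-! ### New parents for the cells -/

/-- The row words of length `l + 1 + r` with the initial word of length `l` in `Q` and the next row
in `H`. -/
def midRows (S : DigitSystem n m a) (Q H : Finset ℕ) (r : ℕ) : Finset ℕ :=
  glue (m ^ (r + 1)) Q (glue (m ^ r) H (S.rowSet r))

theorem mem_midRows {Q H : Finset ℕ} {r y : ℕ} (hH : H ⊆ S.J) :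
    y ∈ S.midRows Q H r ↔
      y / m ^ (r + 1) ∈ Q ∧ y / m ^ r % m ∈ H ∧ y % m ^ r ∈ S.rowSet r := by
  have h1 : ∀ l ∈ S.rowSet r, l < m ^ r := fun l hl => S.lt_of_mem_rowSet hl
  have h2 : ∀ l ∈ glue (m ^ r) H (S.rowSet r), l < m ^ (r + 1) := by
    intro l hl
    rw [mem_glue h1] at hl
    have := S.J_lt _ (hH hl.1)
    rw [pow_succ']
    exact (Nat.div_lt_iff_lt_mul ((Nat.zero_le _).trans_lt (h1 _ hl.2))).1 this
  rw [midRows, mem_glue h2, mem_glue h1, pow_succ, Nat.mod_mul_right_div_self,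
    Nat.mod_mul_right_mod]

theorem card_midRows {Q H : Finset ℕ} {r : ℕ} (hH : H ⊆ S.J) :
    (S.midRows Q H r).card = Q.card * (H.card * S.J.card ^ r) := by
  have h1 : ∀ l ∈ S.rowSet r, l < m ^ r := fun l hl => S.lt_of_mem_rowSet hl
  have h2 : ∀ l ∈ glue (m ^ r) H (S.rowSet r), l < m ^ (r + 1) := by
    intro l hl
    rw [mem_glue h1] at hl
    have := S.J_lt _ (hH hl.1)
    rw [pow_succ']
    exact (Nat.div_lt_iff_lt_mul ((Nat.zero_le _).trans_lt (h1 _ hl.2))).1 this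
  rw [midRows, card_glue h2, card_glue h1, card_rowSet]

theorem mem_rowSet_iff_midRows {l r y : ℕ} :
    y ∈ S.rowSet (l + 1 + (r + 1)) ↔ y / m ^ (r + 2) ∈ S.rowSet l ∧ y / m ^ (r + 1) % m ∈ S.J ∧
      y / m % m ^ r ∈ S.rowSet r ∧ y % m ∈ S.J := by
  rw [← Nat.add_assoc, mem_rowSet_succ, mem_rowSet_add, mem_rowSet_succ]
  simp only [Nat.div_div_eq_div_mul, ← pow_succ, ← pow_succ']
  tauto

/-- The part of a cluster in the rows over a single word of length `l = k + t₀ + t₁ + e`, cut into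
approximate squares of a deeper level, is a product. -/
theorem mem_side {k t₁ e r q : ℕ} {Q H : Finset ℕ} (hH : H ⊆ S.J)
    (hQ : ∀ x ∈ Q, x = q ∧ x ∈ S.rowSet (k + t₀ + t₁ + e)) (g h : ℕ) (p : ℕ × ℕ) :
    p ∈ glue (n ^ t₀) (glue (n ^ t₁)
        ((S.colSet k (q / m ^ e / m ^ t₀ / m ^ t₁)).filter fun x => cut (n ^ t₀) g x = h)
        (S.colSet t₁ (q / m ^ e / m ^ t₀))) (S.colSet t₀ (q / m ^ e)) ×ˢ
      glue m (S.midRows Q H r) S.J ↔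
    p ∈ S.cells (k + (t₁ + t₀)) (k + t₀ + t₁ + e + 1 + (r + 1)) ∧ p.2 / m ^ (r + 2) ∈ Q ∧
      p.2 / m ^ (r + 1) % m ∈ H ∧ cut (n ^ t₀) g (p.1 / n ^ (t₁ + t₀)) = h := by
  obtain ⟨x, y⟩ := p
  simp only [Finset.mem_product]
  rw [mem_glue fun l hl => S.lt_of_mem_colSet hl, mem_glue fun l hl => S.lt_of_mem_colSet hl,
    mem_glue S.J_lt, mem_midRows hH, mem_cells, Finset.mem_filter]
  simp only
  rw [mem_rowSet_iff_midRows, ← Nat.add_assoc k t₁ t₀, mem_colSet_add, mem_colSet_add,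
    show k + t₀ + t₁ + e + 1 + (r + 1) - (k + t₁ + t₀) = r + 2 + e by omega,
    pow_add m (r + 2) e, ← Nat.div_div_eq_div_mul y, Nat.div_div_eq_div_mul y m (m ^ (r + 1)),
    Nat.div_div_eq_div_mul y m (m ^ r), ← pow_succ', ← pow_succ',
    show n ^ (t₁ + t₀) = n ^ t₀ * n ^ t₁ by ring, ← Nat.div_div_eq_div_mul x]
  constructor
  · rintro ⟨⟨⟨⟨h4, h5⟩, h6⟩, h7⟩, ⟨h8, h9, h10⟩, h11⟩
    obtain ⟨h12, h13⟩ := hQ _ h8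
    refine ⟨⟨⟨h13, hH h9, h10, h11⟩, ?_⟩, h8, h9, h5⟩
    rw [h12]
    exact ⟨⟨h4, h6⟩, h7⟩
  · rintro ⟨⟨⟨h4, h5, h6, h7⟩, ⟨h8, h9⟩, h10⟩, h11, h12, h13⟩
    obtain ⟨h14, h15⟩ := hQ _ h11
    rw [h14] at h8 h9 h10
    exact ⟨⟨⟨⟨h8, h13⟩, h9⟩, h10⟩, ⟨h11, h12, h6⟩, h7⟩

theorem card_filter_cut_le {B g : ℕ} (hg : g < B) (U : Finset ℕ) (h : ℕ) :
    (U.filter fun x => cut B g x = h).card ≤ B := by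
  rcases (U.filter fun x => cut B g x = h).eq_empty_or_nonempty with h0 | h0
  · simp [h0]
  · have hsub : (U.filter fun x => cut B g x = h) ⊆
        Finset.Ico ((U.filter fun x => cut B g x = h).min' h0)
          ((U.filter fun x => cut B g x = h).min' h0 + B) := by
      intro x hx
      rw [Finset.mem_Ico]
      refine ⟨Finset.min'_le _ _ hx, lt_add_of_cut_eq hg ?_⟩
      rw [(Finset.mem_filter.1 hx).2, (Finset.mem_filter.1 (Finset.min'_mem _ h0)).2]
    simpa using Finset.card_le_card hsub

theorem cut_eq_iff_side {B g y z : ℕ} (hg : g < B) (hy : y % B ≠ g) :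
    cut B g y = z ↔ ∃ b : Bool, y / B + (if b then 0 else 1) = z ∧
      (if b then y % B < g else g < y % B) := by
  simp only [Bool.exists_bool, if_true, Bool.false_eq_true, if_false, Nat.add_zero]
  rcases lt_or_gt_of_ne hy with h | h
  · rw [cut_eq_div h hg]
    omega
  · rw [cut_eq_div_add_one h hg]
    omega

/-- The redistribution inside a single cluster, which consists of the cells with the label `(z, h)`.

The cells lie in the rows of the word `z` (the side `true`) and of the word `z - 1` (the side
`false`). On each side the approximate squares of the next level form a product, which the cyclic
ranks of their new labels divide into items of `a ^ t₀ * #J` squares each. A new label determines the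
item, except for the labels in the middle slab where the two sides meet. There the cyclic rank of
the slab vanishes, and there are so few such items that they can all go to the same cell. -/
theorem exists_distribution (hvm : v₀ < m) (hv : v₀ ∉ S.J) (ht₀ : 2 * a ^ t₀ < n ^ t₀)
    {k t₁ e r : ℕ} (hk : t₀ ≤ k) (hM : 2 ≤ S.J.card → 2 * n ^ t₀ ≤ S.J.card ^ r) (z h : ℕ) :
    ∃ F : ℕ × ℕ → ℕ × ℕ,
      (∀ p ∈ S.cells (k + (t₁ + t₀)) (k + t₀ + t₁ + e + 1 + (r + 1)),
        S.label v₀ t₀ k (k + t₀ + t₁ + e + 1) (p.1 / n ^ (t₁ + t₀), p.2 / m ^ (r + 1)) = (z, h) →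
          F p ∈ S.cells k (k + t₀ + t₁ + e + 1) ∧
          S.label v₀ t₀ k (k + t₀ + t₁ + e + 1) (F p) = (z, h)) ∧
      (∀ c ∈ S.cells k (k + t₀ + t₁ + e + 1), S.label v₀ t₀ k (k + t₀ + t₁ + e + 1) c = (z, h) →
        ((S.cells (k + (t₁ + t₀)) (k + t₀ + t₁ + e + 1 + (r + 1))).filter fun p =>
          S.label v₀ t₀ k (k + t₀ + t₁ + e + 1) (p.1 / n ^ (t₁ + t₀), p.2 / m ^ (r + 1)) = (z, h) ∧
            F p = c).card = a ^ (t₁ + t₀) * S.J.card ^ (r + 1)) ∧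
      (∀ p ∈ S.cells (k + (t₁ + t₀)) (k + t₀ + t₁ + e + 1 + (r + 1)),
        ∀ p' ∈ S.cells (k + (t₁ + t₀)) (k + t₀ + t₁ + e + 1 + (r + 1)),
        S.label v₀ t₀ k (k + t₀ + t₁ + e + 1) (p.1 / n ^ (t₁ + t₀), p.2 / m ^ (r + 1)) = (z, h) →
        S.label v₀ t₀ k (k + t₀ + t₁ + e + 1) (p'.1 / n ^ (t₁ + t₀), p'.2 / m ^ (r + 1)) = (z, h) →
        S.label v₀ t₀ (k + (t₁ + t₀)) (k + t₀ + t₁ + e + 1 + (r + 1)) p =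
          S.label v₀ t₀ (k + (t₁ + t₀)) (k + t₀ + t₁ + e + 1 + (r + 1)) p' → F p = F p') := by
  classical
  set l₀ := k + t₀ + t₁ + e with hl₀
  set k' := k + (t₁ + t₀) with hk'
  set l' := l₀ + 1 + (r + 1) with hl'
  set g := S.cutCol t₀ k (l₀ + 1) z with hg
  have hgn : g < n ^ t₀ := cutCol_lt ht₀ _ _ _
  let q : Bool → ℕ := fun b => if b then z else z - 1
  let Q : Bool → Finset ℕ := fun b => (S.rowSet l₀).filter fun x => x + (if b then 0 else 1) = z
  let H : Bool → Finset ℕ := fun b => S.J.filter fun j => if b then j < v₀ else v₀ < j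
  let B : Bool → Finset ℕ := fun b =>
    (S.colSet k (q b / m ^ e / m ^ t₀ / m ^ t₁)).filter fun x => cut (n ^ t₀) g x = h
  let U : Bool → Finset ℕ := fun b => glue (n ^ t₁) (B b) (S.colSet t₁ (q b / m ^ e / m ^ t₀))
  let W : Bool → Finset ℕ := fun b => S.midRows (Q b) (H b) r
  let A' : Bool → Finset (ℕ × ℕ) := fun b =>
    glue (n ^ t₀) (U b) (S.colSet t₀ (q b / m ^ e)) ×ˢ glue m (W b) S.J
  let A : Bool → Finset (ℕ × ℕ) := fun b => B b ×ˢ glue m (Q b) (H b)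
  have hHJ : ∀ b, H b ⊆ S.J := fun b => Finset.filter_subset _ _
  have hHm : ∀ b, ∀ j ∈ H b, j < m := fun b j hj => S.J_lt j (hHJ b hj)
  have hQ : ∀ b, ∀ x ∈ Q b, x = q b ∧ x ∈ S.rowSet l₀ := by
    intro b x hx
    rw [Finset.mem_filter] at hx
    refine ⟨?_, hx.1⟩
    cases b
    · simp only [Bool.false_eq_true, if_false] at hx
      simp only [q, Bool.false_eq_true, if_false]
      omega
    · simpa [q] using hx.2
  have hqrow : ∀ b, (Q b).Nonempty → q b ∈ S.rowSet l₀ := by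
    rintro b ⟨x, hx⟩
    obtain ⟨h1, h2⟩ := hQ b x hx
    rwa [← h1]
  have hQb : ∀ b b' x, x ∈ Q b → x ∈ Q b' → b = b' := by
    intro b b' x hx hx'
    have h1 := (Finset.mem_filter.1 hx).2
    have h2 := (Finset.mem_filter.1 hx').2
    cases b <;> cases b' <;> simp_all
  -- The cells of the cluster and their descendants, side by side.
  have hmemA' : ∀ b p, p ∈ A' b ↔ p ∈ S.cells k' l' ∧ p.2 / m ^ (r + 2) ∈ Q b ∧
      p.2 / m ^ (r + 1) % m ∈ H b ∧ cut (n ^ t₀) g (p.1 / n ^ (t₁ + t₀)) = h :=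
    fun b p => mem_side (hHJ b) (hQ b) g h p
  have hmemA : ∀ b p, p ∈ A b ↔ p ∈ S.cells k (l₀ + 1) ∧ p.2 / m ∈ Q b ∧ p.2 % m ∈ H b ∧
      cut (n ^ t₀) g p.1 = h := by
    intro b p
    simp only [A, B, Finset.mem_product, mem_glue (hHm b), Finset.mem_filter, mem_cells]
    rw [mem_rowSet_succ, show l₀ + 1 - k = 1 + e + t₀ + t₁ by omega]
    simp only [pow_add, pow_one, ← Nat.div_div_eq_div_mul]
    constructor
    · rintro ⟨⟨h1, h2⟩, h3, h4⟩
      obtain ⟨h5, h6⟩ := hQ b _ h3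
      exact ⟨⟨⟨h6, hHJ b h4⟩, by rwa [h5]⟩, h3, h4, h2⟩
    · rintro ⟨⟨⟨h6, h7⟩, h1⟩, h3, h4, h2⟩
      obtain ⟨h5, -⟩ := hQ b _ h3
      exact ⟨⟨by rwa [h5] at h1, h2⟩, h3, h4⟩
  have hlab : ∀ p ∈ S.cells k (l₀ + 1), (S.label v₀ t₀ k (l₀ + 1) p = (z, h) ↔
      ∃ b, p.2 / m ∈ Q b ∧ p.2 % m ∈ H b ∧ cut (n ^ t₀) g p.1 = h) := by
    intro p hp
    rw [mem_cells, mem_rowSet_succ] at hp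
    have hne : p.2 % m ≠ v₀ := fun h' => hv (h' ▸ hp.1.2)
    have h1 := cut_eq_iff_side (z := z) hvm hne
    simp only [label, Prod.mk.injEq]
    constructor
    · rintro ⟨h2, h3⟩
      obtain ⟨b, hb, hb'⟩ := h1.1 h2
      rw [h2] at h3
      exact ⟨b, Finset.mem_filter.2 ⟨hp.1.1, hb⟩, Finset.mem_filter.2 ⟨hp.1.2, hb'⟩, h3⟩
    · rintro ⟨b, hb, hb', h3⟩
      have h2 := h1.2 ⟨b, (Finset.mem_filter.1 hb).2, (Finset.mem_filter.1 hb').2⟩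
      rw [h2]
      exact ⟨rfl, h3⟩
  have hpar : ∀ p ∈ S.cells k' l', (p.1 / n ^ (t₁ + t₀), p.2 / m ^ (r + 1)) ∈
      S.cells k (l₀ + 1) := fun p hp => S.div_mem_cells (by omega) hp
  have hclsA : ∀ p, p ∈ Finset.univ.biUnion A ↔
      p ∈ S.cells k (l₀ + 1) ∧ S.label v₀ t₀ k (l₀ + 1) p = (z, h) := by
    intro p
    simp only [Finset.mem_biUnion, Finset.mem_univ, true_and, hmemA]
    constructor
    · rintro ⟨b, hp, hb⟩
      exact ⟨hp, (hlab p hp).2 ⟨b, hb⟩⟩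
    · rintro ⟨hp, hp'⟩
      obtain ⟨b, hb⟩ := (hlab p hp).1 hp'
      exact ⟨b, hp, hb⟩
  have hclsA' : ∀ p, p ∈ Finset.univ.biUnion A' ↔ p ∈ S.cells k' l' ∧
      S.label v₀ t₀ k (l₀ + 1) (p.1 / n ^ (t₁ + t₀), p.2 / m ^ (r + 1)) = (z, h) := by
    intro p
    have hdd : p.2 / m ^ (r + 1) / m = p.2 / m ^ (r + 2) := by
      rw [Nat.div_div_eq_div_mul, ← pow_succ]
    simp only [Finset.mem_biUnion, Finset.mem_univ, true_and, hmemA']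
    constructor
    · rintro ⟨b, hp, hb⟩
      exact ⟨hp, (hlab _ (hpar p hp)).2 ⟨b, by simpa only [hdd] using hb⟩⟩
    · rintro ⟨hp, hp'⟩
      obtain ⟨b, hb⟩ := (hlab _ (hpar p hp)).1 hp'
      exact ⟨b, hp, by simpa only [hdd] using hb⟩
  rcases (Finset.univ.biUnion A).eq_empty_or_nonempty with hA | hA
  · have hno : ∀ c ∈ S.cells k (l₀ + 1), S.label v₀ t₀ k (l₀ + 1) c ≠ (z, h) := by
      intro c hc hc'
      have := (hclsA c).2 ⟨hc, hc'⟩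
      rw [hA] at this
      exact absurd this (Finset.notMem_empty c)
    exact ⟨id, fun p hp h' => absurd h' (hno _ (hpar p hp)), fun c hc h' => absurd h' (hno c hc),
      fun p hp p' _ h' => absurd h' (hno _ (hpar p hp))⟩
  -- The numbers of cells and items.
  have hcardU : ∀ b, (U b).card = (B b).card * (S.colSet t₁ (q b / m ^ e / m ^ t₀)).card :=
    fun b => card_glue fun l hl => S.lt_of_mem_colSet hl
  have hcardUW : ∀ b, (U b).card * (W b).card = (A b).card * (a ^ t₁ * S.J.card ^ r) := by
    intro b
    rw [hcardU, card_midRows (hHJ b), Finset.card_product, card_glue (hHm b)]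
    rcases (Q b).eq_empty_or_nonempty with h0 | h0
    · simp [h0]
    · have h1 := hqrow b h0
      rw [hl₀, show k + t₀ + t₁ + e = k + t₁ + t₀ + e by omega] at h1
      rw [S.card_colSet (by omega) (S.div_mem_rowSet (S.div_mem_rowSet h1))]
      ring
  let I : Finset (Σ _ : Bool, ℕ × ℕ) :=
    Finset.univ.sigma fun b => Finset.range (U b).card ×ˢ Finset.range (W b).card
  have hcardI : I.card = (Finset.univ.biUnion A).card * (a ^ t₁ * S.J.card ^ r) := by
    rw [Finset.card_sigma, Finset.card_biUnion, Finset.sum_mul]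
    · refine Finset.sum_congr rfl fun b _ => ?_
      rw [Finset.card_product, Finset.card_range, Finset.card_range, hcardUW]
    · intro b _ b' _ hne
      refine Finset.disjoint_left.2 fun p hp hp' => hne ?_
      exact hQb b b' _ ((hmemA b p).1 hp).2.1 ((hmemA b' p).1 hp').2.1
  let itm : Bool → ℕ × ℕ → Σ _ : Bool, ℕ × ℕ := fun b w =>
    ⟨b, cycRank (U b) w.2, cycRank (W b) w.1⟩
  let item : ℕ × ℕ → Σ _ : Bool, ℕ × ℕ := fun p =>
    itm (decide (p.2 / m ^ (r + 2) = z)) (S.label v₀ t₀ k' l' p)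
  have hitem : ∀ b, ∀ p ∈ A' b, item p = itm b (S.label v₀ t₀ k' l' p) := by
    intro b p hp
    have h1 := (Finset.mem_filter.1 ((hmemA' b p).1 hp).2.1).2
    have h2 : decide (p.2 / m ^ (r + 2) = z) = b := by
      cases b
      · simp only [Bool.false_eq_true, if_false] at h1
        exact decide_eq_false (by omega)
      · simp only [if_true, Nat.add_zero] at h1
        exact decide_eq_true h1
    simp only [item, h2]
  have hfib : ∀ x ∈ I, ((Finset.univ.biUnion A').filter fun p => item p = x).card =
      a ^ t₀ * S.J.card := by
    rintro ⟨b, i, j⟩ hx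
    simp only [I, Finset.mem_sigma, Finset.mem_univ, true_and, Finset.mem_product,
      Finset.mem_range] at hx
    have hQne : (Q b).Nonempty := by
      rw [Finset.nonempty_iff_ne_empty]
      intro h0
      have h1 := hx.2
      rw [card_midRows (hHJ b), h0] at h1
      simp at h1
    have h1 := hqrow b hQne
    rw [hl₀, show k + t₀ + t₁ + e = k + t₁ + t₀ + e by omega] at h1
    rw [← S.card_colSet (show t₀ ≤ k + t₁ + t₀ by omega) (S.div_mem_rowSet h1)]
    rw [← card_filter_cycRank_cut_prod (g := S.cutCol t₀ k' l')
      (fun l hl => S.lt_of_mem_colSet hl) S.J_lt hvm hv ?_ hx.1 hx.2]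
    · congr 1
      ext p
      rw [Finset.mem_filter, Finset.mem_filter, Finset.mem_biUnion]
      constructor
      · rintro ⟨⟨b', -, hp⟩, hpx⟩
        rw [hitem b' p hp] at hpx
        obtain rfl : b' = b := congrArg Sigma.fst hpx
        simp only [itm, label, Sigma.mk.injEq, heq_eq_eq, true_and, Prod.mk.injEq] at hpx
        exact ⟨hp, hpx⟩
      · rintro ⟨hp, hpx⟩
        refine ⟨⟨b, Finset.mem_univ _, hp⟩, ?_⟩
        rw [hitem b p hp]
        simp only [itm, label, hpx.1, hpx.2]
    · intro y hy
      refine ⟨cutCol_lt ht₀ _ _ _, ?_⟩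
      rw [mem_glue S.J_lt, mem_midRows (hHJ b), Nat.div_div_eq_div_mul, Nat.div_div_eq_div_mul,
        ← pow_succ', ← pow_succ'] at hy
      obtain ⟨⟨hy1, hy2, hy3⟩, hy4⟩ := hy
      obtain ⟨hy5, hy6⟩ := hQ b _ hy1
      have h2 := cutCol_notMem hvm hv ht₀ (show k' + 1 ≤ l' by omega)
        (S.mem_rowSet_iff_midRows.2 ⟨hy6, hHJ b hy2, hy3, hy4⟩)
      rw [show l' - k' = r + 2 + e by omega, pow_add, ← Nat.div_div_eq_div_mul, hy5] at h2
      exact h2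
  have hitemI : ∀ p ∈ Finset.univ.biUnion A', item p ∈ I := by
    intro p hp
    obtain ⟨b, -, hp⟩ := Finset.mem_biUnion.1 hp
    rw [hitem b p hp]
    obtain ⟨h1, h2⟩ := Finset.mem_product.1 hp
    rw [mem_glue fun l hl => S.lt_of_mem_colSet hl] at h1
    rw [mem_glue S.J_lt] at h2
    simp only [I, itm, Finset.mem_sigma, Finset.mem_univ, true_and, Finset.mem_product,
      Finset.mem_range]
    exact ⟨cycRank_lt ⟨_, h1.1⟩ _, cycRank_lt ⟨_, h2.1⟩ _⟩
  -- The items of the middle slab, which matter only if both sides are present.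
  obtain ⟨f, hfA, hfM, hfconst⟩ : ∃ f : (Σ _ : Bool, ℕ × ℕ) → ℕ × ℕ,
      (∀ i, f i ∈ Finset.univ.biUnion A) ∧ (∀ c ∈ Finset.univ.biUnion A,
        (I.filter fun i => f i = c).card = a ^ t₁ * S.J.card ^ r) ∧
      ((A' true).Nonempty → (A' false).Nonempty → ∀ i ∈ I, ∀ j ∈ I, i.2.2 = 0 → j.2.2 = 0 →
        f i = f j) := by
    by_cases hboth : (A' true).Nonempty ∧ (A' false).Nonempty
    · obtain ⟨⟨p, hp⟩, ⟨p', hp'⟩⟩ := hboth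
      have hp1 := Finset.mem_filter.1 ((hmemA' _ _).1 hp).2.2.1
      have hp2 := Finset.mem_filter.1 ((hmemA' _ _).1 hp').2.2.1
      simp only [if_true, Bool.false_eq_true, if_false] at hp1 hp2
      have hJ2 : 2 ≤ S.J.card := Finset.one_lt_card.2
        ⟨_, hp1.1, _, hp2.1, fun h' => by have := hp1.2; have := hp2.2; omega⟩
      have hUle : ∀ b, (U b).card ≤ n ^ t₀ * a ^ t₁ := fun b => by
        rw [hcardU]
        exact Nat.mul_le_mul (card_filter_cut_le hgn _ _) (S.card_colSet_le _ _)
      have hScard : (I.filter fun i => i.2.2 = 0).card ≤ a ^ t₁ * S.J.card ^ r := by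
        have hsub : (I.filter fun i => i.2.2 = 0) ⊆
            Finset.univ.sigma fun b => Finset.range (U b).card ×ˢ {0} := by
          rintro ⟨b, i, j⟩ hx
          simp only [I, Finset.mem_filter, Finset.mem_sigma, Finset.mem_univ, true_and,
            Finset.mem_product, Finset.mem_range, Finset.mem_singleton] at hx ⊢
          exact ⟨hx.1.1, hx.2⟩
        have h1 := Finset.card_le_card hsub
        rw [Finset.card_sigma, Fintype.sum_bool] at h1
        simp only [Finset.card_product, Finset.card_range, Finset.card_singleton, mul_one] at h1
        have h2 := Nat.mul_le_mul_left (a ^ t₁) (hM hJ2)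
        have h3 := hUle true
        have h4 := hUle false
        linarith
      obtain ⟨f, h1, h2, h3⟩ := exists_equal_fibers_const_on hA hcardI
        (Finset.filter_subset (fun i => i.2.2 = 0) I) hScard
      exact ⟨f, h1, h2, fun _ _ i hi j hj hi0 hj0 =>
        h3 i (Finset.mem_filter.2 ⟨hi, hi0⟩) j (Finset.mem_filter.2 ⟨hj, hj0⟩)⟩
    · obtain ⟨f, h1, h2⟩ := exists_equal_fibers hA I hcardI
      exact ⟨f, h1, h2, fun h3 h4 => absurd ⟨h3, h4⟩ hboth⟩
  refine ⟨fun p => f (item p), fun p _ _ => (hclsA _).1 (hfA _), fun c hc hc' => ?_,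
    fun p hp p' hp' hpl hpl' hpp => ?_⟩
  · have hset : ((S.cells k' l').filter fun p => S.label v₀ t₀ k (l₀ + 1)
        (p.1 / n ^ (t₁ + t₀), p.2 / m ^ (r + 1)) = (z, h) ∧ f (item p) = c) =
        (Finset.univ.biUnion A').filter fun p => f (item p) = c := by
      ext p
      rw [Finset.mem_filter, Finset.mem_filter, hclsA', and_assoc]
    rw [hset, Finset.card_eq_sum_card_fiberwise (f := item) (t := I.filter fun i => f i = c)]
    swap
    · intro p hp
      obtain ⟨hp1, hp2⟩ := Finset.mem_filter.1 hp
      exact Finset.mem_coe.2 (Finset.mem_filter.2 ⟨hitemI p hp1, hp2⟩)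
    have hsum : ∀ x ∈ I.filter fun i => f i = c,
        (((Finset.univ.biUnion A').filter fun p => f (item p) = c).filter
          fun p => item p = x).card = a ^ t₀ * S.J.card := by
      intro x hx
      obtain ⟨hx1, hx2⟩ := Finset.mem_filter.1 hx
      rw [← hfib x hx1, Finset.filter_filter]
      congr 1
      refine Finset.filter_congr fun p _ => ?_
      constructor
      · exact fun h' => h'.2
      · intro h'
        exact ⟨by rw [h', hx2], h'⟩
    rw [Finset.sum_congr rfl hsum, Finset.sum_const, hfM c ((hclsA c).2 ⟨hc, hc'⟩), smul_eq_mul]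
    ring
  · have hi := hitemI p ((hclsA' p).2 ⟨hp, hpl⟩)
    have hi' := hitemI p' ((hclsA' p').2 ⟨hp', hpl'⟩)
    obtain ⟨b, -, hb⟩ := Finset.mem_biUnion.1 ((hclsA' p).2 ⟨hp, hpl⟩)
    obtain ⟨b', -, hb'⟩ := Finset.mem_biUnion.1 ((hclsA' p').2 ⟨hp', hpl'⟩)
    -- A label that occurs on both sides is that of the middle slab.
    have hmid : ∀ u ∈ A' true, ∀ v ∈ A' false, cut m v₀ u.2 = cut m v₀ v.2 →
        cycRank (W true) (cut m v₀ u.2) = 0 ∧ cycRank (W false) (cut m v₀ u.2) = 0 := by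
      intro u hu v hv' huv
      have hu2 := (Finset.mem_filter.1 ((hmemA' _ _).1 hu).2.1).2
      have hv2 := (Finset.mem_filter.1 ((hmemA' _ _).1 hv').2.1).2
      simp only [if_true, Bool.false_eq_true, if_false, Nat.add_zero] at hu2 hv2
      rw [show r + 2 = 1 + (r + 1) by omega, pow_add, pow_one, ← Nat.div_div_eq_div_mul] at hu2 hv2
      have hmr : 0 < m ^ (r + 1) := pow_pos (by omega) _
      have h1 : z * m ^ (r + 1) ≤ cut m v₀ u.2 :=
        ((Nat.le_div_iff_mul_le hmr).1 hu2.ge).trans (div_le_cut m v₀ u.2)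
      have h2 : cut m v₀ u.2 ≤ z * m ^ (r + 1) := by
        rw [huv]
        refine (cut_le_div_add_one hvm v.2).trans ?_
        exact (Nat.div_lt_iff_lt_mul hmr).1 (by omega)
      rw [le_antisymm h2 h1]
      constructor
      · refine cycRank_eq_zero_of_forall_le fun w hw => ?_
        have hw2 := (Finset.mem_filter.1 ((mem_midRows (hHJ _)).1 hw).1).2
        simp only [if_true, Nat.add_zero] at hw2
        exact (Nat.le_div_iff_mul_le hmr).1 hw2.ge
      · refine cycRank_eq_zero_of_forall_lt fun w hw => ?_
        have hw2 := (Finset.mem_filter.1 ((mem_midRows (hHJ _)).1 hw).1).2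
        simp only [Bool.false_eq_true, if_false] at hw2
        exact (Nat.div_lt_iff_lt_mul hmr).1 (by omega)
    have hcut : cut m v₀ p.2 = cut m v₀ p'.2 := congrArg Prod.fst hpp
    have e1 := hitem b p hb
    have e2 := hitem b' p' hb'
    change f (item p) = f (item p')
    by_cases hbb : b = b'
    · subst hbb
      rw [e1, e2, hpp]
    · cases b <;> cases b' <;> try exact absurd rfl hbb
      · obtain ⟨h1, h2⟩ := hmid p' hb' p hb hcut.symm
        refine hfconst ⟨p', hb'⟩ ⟨p, hb⟩ _ hi _ hi' ?_ ?_
        · rw [e1]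
          simp only [itm, label, hcut]
          exact h2
        · rw [e2]
          exact h1
      · obtain ⟨h1, h2⟩ := hmid p hb p' hb' hcut
        refine hfconst ⟨p, hb⟩ ⟨p', hb'⟩ _ hi _ hi' ?_ ?_
        · rw [e1]
          exact h1
        · rw [e2]
          simp only [itm, label, ← hcut]
          exact h2

/-- New parents for all cells of a level: they depend only on the label, have the same label as the
true parents, and have equally many children. -/
theorem exists_parent (hvm : v₀ < m) (hv : v₀ ∉ S.J) (ht₀ : 2 * a ^ t₀ < n ^ t₀)
    {k t l r : ℕ} (hk : t₀ ≤ k) (ht : t₀ ≤ t) (hl : k + t + 1 ≤ l) (hr : 1 ≤ r)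
    (hM : 2 ≤ S.J.card → 2 * n ^ t₀ ≤ S.J.card ^ (r - 1)) :
    ∃ F : ℕ × ℕ → ℕ × ℕ,
      (∀ p ∈ S.cells (k + t) (l + r), F p ∈ S.cells k l ∧
        S.label v₀ t₀ k l (F p) = S.label v₀ t₀ k l (p.1 / n ^ t, p.2 / m ^ r)) ∧
      (∀ c ∈ S.cells k l, ((S.cells (k + t) (l + r)).filter fun p => F p = c).card =
        a ^ t * S.J.card ^ r) ∧
      (∀ p ∈ S.cells (k + t) (l + r), ∀ p' ∈ S.cells (k + t) (l + r),
        S.label v₀ t₀ (k + t) (l + r) p = S.label v₀ t₀ (k + t) (l + r) p' → F p = F p') := by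
  obtain ⟨t₁, rfl⟩ := Nat.exists_eq_add_of_le' ht
  obtain ⟨r, rfl⟩ := Nat.exists_eq_add_of_le' hr
  obtain ⟨e, rfl⟩ : ∃ e, l = k + t₀ + t₁ + e + 1 := ⟨l - (k + t₀ + t₁ + 1), by omega⟩
  rw [Nat.add_sub_cancel] at hM
  choose F hF1 hF2 hF3 using
    fun w : ℕ × ℕ => exists_distribution (t₁ := t₁) (e := e) hvm hv ht₀ hk hM w.1 w.2
  let par : ℕ × ℕ → ℕ × ℕ := fun p => S.label v₀ t₀ k (k + t₀ + t₁ + e + 1)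
    (p.1 / n ^ (t₁ + t₀), p.2 / m ^ (r + 1))
  refine ⟨fun p => F (par p) p, fun p hp => hF1 (par p) p hp rfl, fun c hc => ?_,
    fun p hp p' hp' hpp => ?_⟩
  · rw [← hF2 (S.label v₀ t₀ k (k + t₀ + t₁ + e + 1) c) c hc rfl]
    congr 1
    refine Finset.filter_congr fun p hp => ?_
    constructor
    · intro h
      have h1 : par p = S.label v₀ t₀ k (k + t₀ + t₁ + e + 1) c := by
        rw [← h]
        exact (hF1 (par p) p hp rfl).2.symm
      exact ⟨h1, h1 ▸ h⟩
    · rintro ⟨h1, h2⟩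
      have h1' : par p = S.label v₀ t₀ k (k + t₀ + t₁ + e + 1) c := h1
      change F (par p) p = c
      rw [h1']
      exact h2
  · have h1 : par p = par p' :=
      label_div_eq hvm hv ht₀ hk (by omega) (by omega) (by omega) hp hp' hpp
    change F (par p) p = F (par p') p'
    rw [← h1]
    exact hF3 (par p) p hp p' hp' rfl h1.symm hpp

end DigitSystem

/-! ### Digit sequences and initial words -/

/-- The initial word of length `k` of the sequence `x`, read as an integer in base `b`. -/
def word (b : ℕ) (x : ℕ → ℕ) : ℕ → ℕ
  | 0 => 0
  | k + 1 => b * word b x k + x k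

theorem word_congr {b : ℕ} {x x' : ℕ → ℕ} {k : ℕ} (h : ∀ i < k, x i = x' i) :
    word b x k = word b x' k := by
  induction k with
  | zero => rfl
  | succ k ih => rw [word, word, ih fun i hi => h i (by omega), h k (by omega)]

theorem word_succ_div {b : ℕ} {x : ℕ → ℕ} {k : ℕ} (h : x k < b) :
    word b x (k + 1) / b = word b x k := by
  rw [word, Nat.mul_add_div (by omega), Nat.div_eq_of_lt h, Nat.add_zero]

theorem word_add_div {b : ℕ} {x : ℕ → ℕ} (h : ∀ i, x i < b) (k t : ℕ) :
    word b x (k + t) / b ^ t = word b x k := by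
  induction t with
  | zero => simp
  | succ t ih => rw [← Nat.add_assoc, pow_succ', ← Nat.div_div_eq_div_mul, word_succ_div (h _), ih]

namespace DigitSystem

variable {n m a : ℕ} (S : DigitSystem n m a)

/-- The digit sequences. -/
structure Code where
  /-- The digit at an index. -/
  digit : ℕ → ℕ × ℕ
  digit_mem : ∀ i, (digit i).1 ∈ S.R (digit i).2

variable {S}

theorem mem_J_of_mem_R {x y : ℕ} (h : x ∈ S.R y) : y ∈ S.J := by
  by_contra hy
  rw [S.R_eq_empty y hy] at h
  exact absurd h (Finset.notMem_empty x)

/-- The initial word of length `k` of the first coordinates. -/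
def Code.X (w : S.Code) (k : ℕ) : ℕ := word n (fun i => (w.digit i).1) k

/-- The initial word of length `l` of the second coordinates. -/
def Code.Y (w : S.Code) (l : ℕ) : ℕ := word m (fun i => (w.digit i).2) l

theorem Code.fst_lt (w : S.Code) (i : ℕ) : (w.digit i).1 < n := S.R_lt _ _ (w.digit_mem i)

theorem Code.snd_mem (w : S.Code) (i : ℕ) : (w.digit i).2 ∈ S.J := mem_J_of_mem_R (w.digit_mem i)

theorem Code.snd_lt (w : S.Code) (i : ℕ) : (w.digit i).2 < m := S.J_lt _ (w.snd_mem i)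

theorem Code.X_succ (w : S.Code) (k : ℕ) : w.X (k + 1) = n * w.X k + (w.digit k).1 := rfl

theorem Code.Y_succ (w : S.Code) (l : ℕ) : w.Y (l + 1) = m * w.Y l + (w.digit l).2 := rfl

theorem Code.X_add_div (w : S.Code) (k t : ℕ) : w.X (k + t) / n ^ t = w.X k :=
  word_add_div w.fst_lt k t

theorem Code.Y_add_div (w : S.Code) (l r : ℕ) : w.Y (l + r) / m ^ r = w.Y l :=
  word_add_div w.snd_lt l r

theorem Code.X_succ_mod (w : S.Code) (k : ℕ) : w.X (k + 1) % n = (w.digit k).1 := by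
  rw [X_succ, Nat.mul_add_mod, Nat.mod_eq_of_lt (w.fst_lt k)]

theorem Code.Y_succ_mod (w : S.Code) (l : ℕ) : w.Y (l + 1) % m = (w.digit l).2 := by
  rw [Y_succ, Nat.mul_add_mod, Nat.mod_eq_of_lt (w.snd_lt l)]

theorem Code.X_succ_div (w : S.Code) (k : ℕ) : w.X (k + 1) / n = w.X k := by
  simpa using w.X_add_div k 1

theorem Code.Y_succ_div (w : S.Code) (l : ℕ) : w.Y (l + 1) / m = w.Y l := by
  simpa using w.Y_add_div l 1

theorem Code.Y_mem (w : S.Code) (l : ℕ) : w.Y l ∈ S.rowSet l := by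
  induction l with
  | zero => exact Finset.mem_singleton_self 0
  | succ l ih =>
    rw [mem_rowSet_succ, w.Y_succ_div, w.Y_succ_mod]
    exact ⟨ih, w.snd_mem l⟩

theorem Code.X_mem (w : S.Code) (k : ℕ) : w.X k ∈ S.colSet k (w.Y k) := by
  induction k with
  | zero => exact Finset.mem_singleton_self 0
  | succ k ih =>
    rw [mem_colSet_succ, w.X_succ_div, w.X_succ_mod, w.Y_succ_div, w.Y_succ_mod]
    exact ⟨ih, w.digit_mem k⟩

theorem Code.mem_cells (w : S.Code) {k l : ℕ} (hkl : k ≤ l) : (w.X k, w.Y l) ∈ S.cells k l := by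
  rw [DigitSystem.mem_cells]
  refine ⟨w.Y_mem l, ?_⟩
  obtain ⟨d, rfl⟩ := Nat.exists_eq_add_of_le hkl
  simp only [Nat.add_sub_cancel_left, w.Y_add_div]
  exact w.X_mem k

/-- Replacing the digit at the index `k`. -/
def Code.update (w : S.Code) (k : ℕ) {x y : ℕ} (h : x ∈ S.R y) : S.Code where
  digit := Function.update w.digit k (x, y)
  digit_mem i := by
    by_cases hi : i = k
    · subst hi
      simpa using h
    · rw [Function.update_of_ne hi]
      exact w.digit_mem i

theorem Code.update_digit_of_ne (w : S.Code) {k x y : ℕ} (h : x ∈ S.R y) {i : ℕ} (hi : i ≠ k) :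
    (w.update k h).digit i = w.digit i := Function.update_of_ne hi _ _

theorem Code.update_digit_self (w : S.Code) {k x y : ℕ} (h : x ∈ S.R y) :
    (w.update k h).digit k = (x, y) := Function.update_self _ _ _

theorem Code.update_X (w : S.Code) {k x y : ℕ} (h : x ∈ S.R y) {i : ℕ} (hi : i ≤ k) :
    (w.update k h).X i = w.X i :=
  word_congr fun j hj => by rw [w.update_digit_of_ne h (by omega)]

theorem Code.update_Y (w : S.Code) {k x y : ℕ} (h : x ∈ S.R y) {i : ℕ} (hi : i ≤ k) :
    (w.update k h).Y i = w.Y i :=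
  word_congr fun j hj => by rw [w.update_digit_of_ne h (by omega)]

theorem Code.update_X_succ (w : S.Code) {k x y : ℕ} (h : x ∈ S.R y) :
    (w.update k h).X (k + 1) = n * w.X k + x := by
  rw [X_succ, w.update_X h le_rfl, w.update_digit_self]

theorem Code.update_Y_succ (w : S.Code) {k x y : ℕ} (h : x ∈ S.R y) :
    (w.update k h).Y (k + 1) = m * w.Y k + y := by
  rw [Y_succ, w.update_Y h le_rfl, w.update_digit_self]

/-- Every cell is the initial part of a digit sequence. -/
theorem exists_code (ha : 0 < a) (hJ : S.J.Nonempty) {k l : ℕ} (hkl : k ≤ l) {p : ℕ × ℕ}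
    (hp : p ∈ S.cells k l) : ∃ w : S.Code, w.X k = p.1 ∧ w.Y l = p.2 := by
  have hR : ∀ y ∈ S.J, ∃ x, x ∈ S.R y := fun y hy =>
    Finset.card_pos.1 (by rw [S.card_R y hy]; exact ha)
  obtain ⟨y₀, hy₀⟩ := hJ
  obtain ⟨x₀, hx₀⟩ := hR y₀ hy₀
  have hsq : ∀ k x y, y ∈ S.rowSet k → x ∈ S.colSet k y → ∃ w : S.Code, w.X k = x ∧ w.Y k = y := by
    intro k
    induction k with
    | zero =>
      intro x y hy hx
      rw [Finset.mem_singleton.1 hy, Finset.mem_singleton.1 hx]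
      exact ⟨⟨fun _ => (x₀, y₀), fun _ => hx₀⟩, rfl, rfl⟩
    | succ k ih =>
      intro x y hy hx
      rw [mem_rowSet_succ] at hy
      rw [mem_colSet_succ] at hx
      obtain ⟨w, hw1, hw2⟩ := ih _ _ hy.1 hx.1
      refine ⟨w.update k hx.2, ?_, ?_⟩
      · rw [w.update_X_succ, hw1, Nat.div_add_mod]
      · rw [w.update_Y_succ, hw2, Nat.div_add_mod]
  obtain ⟨x, y⟩ := p
  rw [DigitSystem.mem_cells] at hp
  obtain ⟨d, rfl⟩ := Nat.exists_eq_add_of_le hkl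
  clear hkl
  simp only [Nat.add_sub_cancel_left] at hp ⊢
  induction d generalizing y with
  | zero => exact hsq k x y hp.1 (by simpa using hp.2)
  | succ d ih =>
    rw [← Nat.add_assoc, mem_rowSet_succ, pow_succ', ← Nat.div_div_eq_div_mul] at hp
    obtain ⟨w, hw1, hw2⟩ := ih (y / m) ⟨hp.1.1, hp.2⟩
    obtain ⟨x', hx'⟩ := hR _ hp.1.2
    refine ⟨w.update (k + d) hx', ?_, ?_⟩
    · rw [w.update_X hx' (by omega), hw1]
    · rw [← Nat.add_assoc, w.update_Y_succ, hw2, Nat.div_add_mod]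

/-! ### Points of the carpet and their codes -/

/-- The point `z` lies in all the rectangles `[X_k, X_k + 1] / n ^ k × [Y_k, Y_k + 1] / m ^ k` of the
digit sequence `w`. -/
def Coded (z : EuclideanSpace ℝ (Fin 2)) (w : S.Code) : Prop :=
  ∀ k, ((w.X k : ℝ) ≤ n ^ k * z 0 ∧ n ^ k * z 0 ≤ w.X k + 1) ∧
    ((w.Y k : ℝ) ≤ m ^ k * z 1 ∧ m ^ k * z 1 ≤ w.Y k + 1)

/-- The self-affinity `E = ⋃ S_d(E)`, expressed by coordinates. -/
def SelfAffine (S : DigitSystem n m a) (E : Set (EuclideanSpace ℝ (Fin 2))) : Prop :=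
  ∀ z, z ∈ E ↔ ∃ x y, x ∈ S.R y ∧ ∃ z' ∈ E, n * z 0 = z' 0 + x ∧ m * z 1 = z' 1 + y

variable {E : Set (EuclideanSpace ℝ (Fin 2))}

theorem exists_coord_bound {b : ℕ} (hb : 2 ≤ b) (hne : E.Nonempty) (hc : IsCompact E) {i : Fin 2}
    (h : ∀ z ∈ E, ∃ z' ∈ E, ∃ x : ℕ, x < b ∧ b * z i = z' i + x) :
    ∀ z ∈ E, 0 ≤ z i ∧ z i ≤ 1 := by
  have hcont : ContinuousOn (fun z : EuclideanSpace ℝ (Fin 2) => z i) E := by fun_prop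
  obtain ⟨u, hu, humin⟩ := hc.exists_isMinOn hne hcont
  obtain ⟨v, hv, hvmax⟩ := hc.exists_isMaxOn hne hcont
  rw [isMinOn_iff] at humin
  rw [isMaxOn_iff] at hvmax
  have hb' : (2 : ℝ) ≤ b := by exact_mod_cast hb
  intro z hz
  constructor
  · obtain ⟨u', hu', x, -, hx⟩ := h u hu
    have h1 := humin u' hu'
    have h2 : (0 : ℝ) ≤ x := Nat.cast_nonneg x
    refine le_trans ?_ (humin z hz)
    by_contra! hneg
    nlinarith
  · obtain ⟨v', hv', x, hxb, hx⟩ := h v hv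
    have h1 := hvmax v' hv'
    have h2 : (x : ℝ) + 1 ≤ b := by exact_mod_cast hxb
    refine le_trans (hvmax z hz) ?_
    by_contra! hlt
    nlinarith

theorem SelfAffine.mem_unit (hE : S.SelfAffine E) (hn : 2 ≤ n) (hm : 2 ≤ m) (hne : E.Nonempty)
    (hc : IsCompact E) : ∀ z ∈ E, (0 ≤ z 0 ∧ z 0 ≤ 1) ∧ (0 ≤ z 1 ∧ z 1 ≤ 1) := by
  have h0 := exists_coord_bound (i := 0) hn hne hc fun z hz => by
    obtain ⟨x, y, hxy, z', hz', h1, h2⟩ := (hE z).1 hz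
    exact ⟨z', hz', x, S.R_lt _ _ hxy, h1⟩
  have h1 := exists_coord_bound (i := 1) hm hne hc fun z hz => by
    obtain ⟨x, y, hxy, z', hz', h1, h2⟩ := (hE z).1 hz
    exact ⟨z', hz', y, S.J_lt _ (mem_J_of_mem_R hxy), h2⟩
  exact fun z hz => ⟨h0 z hz, h1 z hz⟩

theorem SelfAffine.exists_coded (hE : S.SelfAffine E)
    (hunit : ∀ z ∈ E, (0 ≤ z 0 ∧ z 0 ≤ 1) ∧ (0 ≤ z 1 ∧ z 1 ≤ 1)) {z : EuclideanSpace ℝ (Fin 2)}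
    (hz : z ∈ E) : ∃ w : S.Code, Coded z w := by
  have hstep : ∀ z : E, ∃ d : ℕ × ℕ, ∃ z' : E, d.1 ∈ S.R d.2 ∧
      n * z.1 0 = z'.1 0 + d.1 ∧ m * z.1 1 = z'.1 1 + d.2 := by
    intro z
    obtain ⟨x, y, hxy, z', hz', h⟩ := (hE z).1 z.2
    exact ⟨(x, y), ⟨z', hz'⟩, hxy, h⟩
  choose d nx hd hx hy using hstep
  let orb : ℕ → E := fun k => nx^[k] ⟨z, hz⟩
  have horb : ∀ k, orb (k + 1) = nx (orb k) := fun k => Function.iterate_succ_apply' nx k _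
  refine ⟨⟨fun k => d (orb k), fun k => hd _⟩, fun k => ?_⟩
  have key : (n : ℝ) ^ k * z 0 = (word n (fun i => (d (orb i)).1) k : ℕ) + (orb k).1 0 ∧
      (m : ℝ) ^ k * z 1 = (word m (fun i => (d (orb i)).2) k : ℕ) + (orb k).1 1 := by
    induction k with
    | zero => simp [word, orb]
    | succ k ih =>
      have h1 := hx (orb k)
      have h2 := hy (orb k)
      rw [pow_succ', pow_succ', mul_assoc, mul_assoc, ih.1, ih.2, horb, word, word]
      push_cast
      constructor
      · linear_combination h1
      · linear_combination h2
  have h3 := hunit _ (orb k).2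
  simp only [Code.X, Code.Y]
  rw [key.1, key.2]
  refine ⟨⟨?_, ?_⟩, ?_, ?_⟩ <;> linarith [h3.1.1, h3.1.2, h3.2.1, h3.2.2]

theorem SelfAffine.exists_point (hE : S.SelfAffine E) (hn : 2 ≤ n) (hm : 2 ≤ m)
    (hne : E.Nonempty) (hc : IsCompact E)
    (hunit : ∀ z ∈ E, (0 ≤ z 0 ∧ z 0 ≤ 1) ∧ (0 ≤ z 1 ∧ z 1 ≤ 1)) (w : S.Code) :
    ∃ z ∈ E, Coded z w := by
  have hn0 : (0 : ℝ) < n := by exact_mod_cast (by omega : 0 < n)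
  have hm0 : (0 : ℝ) < m := by exact_mod_cast (by omega : 0 < m)
  have happrox : ∀ k, ∀ e ∈ E, ∃ p ∈ E, (n : ℝ) ^ k * p 0 = w.X k + e 0 ∧
      (m : ℝ) ^ k * p 1 = w.Y k + e 1 := by
    intro k
    induction k with
    | zero => exact fun e he => ⟨e, he, by simp [Code.X, word], by simp [Code.Y, word]⟩
    | succ k ih =>
      intro e he
      let e' : EuclideanSpace ℝ (Fin 2) :=
        !₂[(e 0 + (w.digit k).1) / n, (e 1 + (w.digit k).2) / m]
      have h0 : (n : ℝ) * e' 0 = e 0 + (w.digit k).1 := by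
        change (n : ℝ) * ((e 0 + (w.digit k).1) / n) = _
        field_simp
      have h1 : (m : ℝ) * e' 1 = e 1 + (w.digit k).2 := by
        change (m : ℝ) * ((e 1 + (w.digit k).2) / m) = _
        field_simp
      obtain ⟨p, hp, hp0, hp1⟩ := ih e' ((hE e').2 ⟨_, _, w.digit_mem k, e, he, h0, h1⟩)
      refine ⟨p, hp, ?_, ?_⟩
      · rw [pow_succ', mul_assoc, hp0, Code.X, Code.X, word]
        push_cast
        linear_combination h0
      · rw [pow_succ', mul_assoc, hp1, Code.Y, Code.Y, word]
        push_cast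
        linear_combination h1
  let t : ℕ → Set (EuclideanSpace ℝ (Fin 2)) := fun k => E ∩
    {z | ((w.X k : ℝ) ≤ n ^ k * z 0 ∧ n ^ k * z 0 ≤ w.X k + 1) ∧
      ((w.Y k : ℝ) ≤ m ^ k * z 1 ∧ m ^ k * z 1 ≤ w.Y k + 1)}
  have hclosed : ∀ k, IsClosed (t k) := by
    intro k
    refine hc.isClosed.inter ?_
    refine IsClosed.and (IsClosed.and ?_ ?_) (IsClosed.and ?_ ?_)
    · exact isClosed_le (by fun_prop) (by fun_prop)
    · exact isClosed_le (by fun_prop) (by fun_prop)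
    · exact isClosed_le (by fun_prop) (by fun_prop)
    · exact isClosed_le (by fun_prop) (by fun_prop)
  have hnest : ∀ (b : ℕ) (x : ℕ → ℕ) (k : ℕ) (u : ℝ), 0 < b → x k < b →
      (word b x (k + 1) : ℝ) ≤ b ^ (k + 1) * u → b ^ (k + 1) * u ≤ word b x (k + 1) + 1 →
      (word b x k : ℝ) ≤ b ^ k * u ∧ b ^ k * u ≤ word b x k + 1 := by
    intro b x k u hb hx h1 h2
    have hb' : (0 : ℝ) < b := by exact_mod_cast hb
    have hx' : (x k : ℝ) + 1 ≤ b := by exact_mod_cast hx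
    have hx0 : (0 : ℝ) ≤ x k := Nat.cast_nonneg _
    rw [pow_succ', mul_assoc, word] at h1 h2
    push_cast at h1 h2
    constructor
    · refine le_of_mul_le_mul_left ?_ hb'
      linarith
    · refine le_of_mul_le_mul_left ?_ hb'
      linarith
  obtain ⟨z, hz⟩ := IsCompact.nonempty_iInter_of_sequence_nonempty_isCompact_isClosed t
    (by
      rintro k z ⟨hz, ⟨h1, h2⟩, h3, h4⟩
      exact ⟨hz, hnest n _ k _ (by omega) (w.fst_lt k) h1 h2,
        hnest m _ k _ (by omega) (w.snd_lt k) h3 h4⟩)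
    (by
      intro k
      obtain ⟨e, he⟩ := hne
      obtain ⟨p, hp, hp0, hp1⟩ := happrox k e he
      have h := hunit e he
      refine ⟨p, hp, ⟨?_, ?_⟩, ?_, ?_⟩ <;> linarith [h.1.1, h.1.2, h.2.1, h.2.2])
    (hc.inter_right (by
      refine IsClosed.and (IsClosed.and ?_ ?_) (IsClosed.and ?_ ?_)
      · exact isClosed_le (by fun_prop) (by fun_prop)
      · exact isClosed_le (by fun_prop) (by fun_prop)
      · exact isClosed_le (by fun_prop) (by fun_prop)
      · exact isClosed_le (by fun_prop) (by fun_prop))) hclosed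
  rw [Set.mem_iInter] at hz
  exact ⟨z, (hz 0).1, fun k => (hz k).2⟩

theorem abs_coord_sub_le_dist (z z' : EuclideanSpace ℝ (Fin 2)) (i : Fin 2) :
    |z i - z' i| ≤ dist z z' := by
  rw [← Real.dist_eq]
  exact PiLp.dist_apply_le z z' i

theorem dist_le_add_abs (z z' : EuclideanSpace ℝ (Fin 2)) :
    dist z z' ≤ |z 0 - z' 0| + |z 1 - z' 1| := by
  rw [EuclideanSpace.dist_eq, Fin.sum_univ_two, Real.dist_eq, Real.dist_eq]
  refine Real.sqrt_le_iff.2 ⟨by positivity, ?_⟩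
  nlinarith [abs_nonneg (z 0 - z' 0), abs_nonneg (z 1 - z' 1)]

end DigitSystem

/-! ### Levels of approximate squares -/

theorem exists_mul_pow_lt {a b : ℕ} (hab : a < b) (c : ℕ) : ∃ t, c * a ^ t < b ^ t := by
  have hb : (0 : ℝ) < b := by exact_mod_cast (by omega : 0 < b)
  have h1 : (a : ℝ) / b < 1 := (div_lt_one hb).2 (by exact_mod_cast hab)
  obtain ⟨t, ht⟩ := exists_pow_lt_of_lt_one (show (0 : ℝ) < 1 / (c + 1) by positivity) h1
  refine ⟨t, ?_⟩
  rw [div_pow, div_lt_div_iff₀ (by positivity) (by positivity), one_mul] at ht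
  have h2 : a ^ t * (c + 1) < b ^ t := by exact_mod_cast ht
  refine lt_of_le_of_lt ?_ h2
  rw [mul_comm]
  exact Nat.mul_le_mul_left _ (Nat.le_succ c)

/-- The number `⌊k / σ⌋` of rows that make an approximate square of width `n ^ (-k)`. -/
def rowLevel (n m k : ℕ) : ℕ := Nat.log m (n ^ k)

theorem rowLevel_zero (n m : ℕ) : rowLevel n m 0 = 0 := by simp [rowLevel]

section rowLevel

variable {n m : ℕ}

theorem pow_rowLevel_le (hmn : m < n) (k : ℕ) : m ^ rowLevel n m k ≤ n ^ k :=
  Nat.pow_log_le_self m (pow_pos (by omega) k).ne'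

theorem lt_pow_rowLevel_succ (hm : 2 ≤ m) (k : ℕ) : n ^ k < m ^ (rowLevel n m k + 1) :=
  Nat.lt_pow_succ_log_self (by omega) _

theorem le_rowLevel (hm : 2 ≤ m) {l k : ℕ} (h : m ^ l ≤ n ^ k) : l ≤ rowLevel n m k :=
  Nat.le_log_of_pow_le (by omega) h

theorem self_le_rowLevel (hm : 2 ≤ m) (hmn : m < n) (k : ℕ) : k ≤ rowLevel n m k :=
  le_rowLevel hm (Nat.pow_le_pow_left hmn.le k)

theorem rowLevel_add_le (hm : 2 ≤ m) (hmn : m < n) (k t : ℕ) :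
    rowLevel n m k + t ≤ rowLevel n m (k + t) := by
  refine le_rowLevel hm ?_
  rw [pow_add, pow_add]
  exact Nat.mul_le_mul (pow_rowLevel_le hmn k) (Nat.pow_le_pow_left hmn.le t)

theorem exists_add_le_rowLevel (hm : 2 ≤ m) (hmn : m < n) (c : ℕ) :
    ∃ k₀, ∀ k ≥ k₀, k + c ≤ rowLevel n m k := by
  obtain ⟨k₀, hk₀⟩ := exists_mul_pow_lt hmn (m ^ c)
  refine ⟨k₀, fun k hk => ?_⟩
  obtain ⟨d, rfl⟩ := Nat.exists_eq_add_of_le hk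
  have h1 : k₀ + c ≤ rowLevel n m k₀ := le_rowLevel hm (by rw [pow_add, mul_comm]; exact hk₀.le)
  have h2 := rowLevel_add_le hm hmn k₀ d
  omega

end rowLevel

namespace DigitSystem

variable {n m a : ℕ} {S : DigitSystem n m a} {v₀ t₀ : ℕ}

/-! ### Labels and distances -/

theorem abs_sub_le_of_word {b k c X X' : ℕ} {u u' : ℝ} (hb : 0 < b) (h1 : (X : ℝ) ≤ b ^ k * u)
    (h2 : b ^ k * u ≤ X + 1) (h1' : (X' : ℝ) ≤ b ^ k * u') (h2' : b ^ k * u' ≤ X' + 1)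
    (h : X' < X + c) (h' : X < X' + c) : |u - u'| ≤ c / b ^ k := by
  have hbk : (0 : ℝ) < b ^ k := pow_pos (by exact_mod_cast hb) k
  have h3 : (X' : ℝ) + 1 ≤ X + c := by exact_mod_cast h
  have h4 : (X : ℝ) + 1 ≤ X' + c := by exact_mod_cast h'
  rw [le_div_iff₀ hbk, ← abs_eq_self.2 hbk.le, ← abs_mul, abs_le]
  constructor <;> nlinarith

theorem le_abs_sub_of_word {b k X X' : ℕ} {u u' : ℝ} (hb : 0 < b)
    (h2 : b ^ k * u ≤ X + 1) (h1' : (X' : ℝ) ≤ b ^ k * u') (h : X + 2 ≤ X') :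
    1 / (b : ℝ) ^ k ≤ |u - u'| := by
  have hbk : (0 : ℝ) < b ^ k := pow_pos (by exact_mod_cast hb) k
  have h3 : (X : ℝ) + 2 ≤ X' := by exact_mod_cast h
  rw [div_le_iff₀ hbk, abs_sub_comm]
  have := le_abs_self (u' - u)
  nlinarith

theorem dist_le_of_label_eq (hm : 2 ≤ m) (hmn : m < n) (hvm : v₀ < m)
    (ht₀ : 2 * a ^ t₀ < n ^ t₀) {k : ℕ} {z z' : EuclideanSpace ℝ (Fin 2)} {w w' : S.Code}
    (hz : Coded z w) (hz' : Coded z' w')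
    (h : S.label v₀ t₀ k (rowLevel n m k) (w.X k, w.Y (rowLevel n m k)) =
      S.label v₀ t₀ k (rowLevel n m k) (w'.X k, w'.Y (rowLevel n m k))) :
    dist z z' ≤ (n ^ t₀ + m * m) * (1 / (n : ℝ)) ^ k := by
  have h1 := congrArg Prod.fst h
  have h2 := congrArg Prod.snd h
  simp only [label] at h1 h2
  rw [← h1] at h2
  have hg := cutCol_lt (S := S) ht₀ k (rowLevel n m k) (cut m v₀ (w.Y (rowLevel n m k)))
  obtain ⟨hx, -⟩ := hz k
  obtain ⟨hx', -⟩ := hz' k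
  obtain ⟨-, hy⟩ := hz (rowLevel n m k)
  obtain ⟨-, hy'⟩ := hz' (rowLevel n m k)
  have d0 := abs_sub_le_of_word (by omega) hx.1 hx.2 hx'.1 hx'.2 (lt_add_of_cut_eq hg h2)
    (lt_add_of_cut_eq hg h2.symm)
  have d1 := abs_sub_le_of_word (by omega) hy.1 hy.2 hy'.1 hy'.2 (lt_add_of_cut_eq hvm h1)
    (lt_add_of_cut_eq hvm h1.symm)
  have hm0 : (0 : ℝ) < m := by exact_mod_cast (by omega : 0 < m)
  have hn0 : (0 : ℝ) < n := by exact_mod_cast (by omega : 0 < n)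
  have hlev : (n : ℝ) ^ k ≤ m ^ rowLevel n m k * m := by
    rw [← pow_succ]
    exact_mod_cast (lt_pow_rowLevel_succ hm k).le
  have h3 : (m : ℝ) / m ^ rowLevel n m k ≤ m * m * (1 / (n : ℝ)) ^ k := by
    rw [one_div, inv_pow, ← div_eq_mul_inv, div_le_div_iff₀ (by positivity) (by positivity)]
    nlinarith
  refine (dist_le_add_abs z z').trans ?_
  rw [add_mul]
  refine add_le_add (d0.trans (le_of_eq ?_)) (d1.trans h3)
  rw [one_div, inv_pow, ← div_eq_mul_inv]
  push_cast
  rfl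

theorem le_dist_of_label_ne (hm : 2 ≤ m) (hmn : m < n) (hvm : v₀ < m) (hv : v₀ ∉ S.J)
    (ht₀ : 2 * a ^ t₀ < n ^ t₀) {k : ℕ} (hk : t₀ ≤ k) (hkl : k + 1 ≤ rowLevel n m k)
    {z z' : EuclideanSpace ℝ (Fin 2)} {w w' : S.Code} (hz : Coded z w) (hz' : Coded z' w')
    (h : S.label v₀ t₀ k (rowLevel n m k) (w.X k, w.Y (rowLevel n m k)) ≠
      S.label v₀ t₀ k (rowLevel n m k) (w'.X k, w'.Y (rowLevel n m k))) :
    (1 / (n : ℝ)) ^ k ≤ dist z z' := by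
  have hm0 : (0 : ℝ) < m := by exact_mod_cast (by omega : 0 < m)
  have hn0 : (0 : ℝ) < n := by exact_mod_cast (by omega : 0 < n)
  rw [one_div_pow]
  by_cases hzz : cut m v₀ (w.Y (rowLevel n m k)) = cut m v₀ (w'.Y (rowLevel n m k))
  · have hcell : ∀ w : S.Code, (w.X k, w.Y (rowLevel n m k)) ∈ S.cells k (rowLevel n m k) :=
      fun w => w.mem_cells (by omega)
    have e1 := mod_ne_cutCol hvm hv ht₀ hkl hk (hcell w)
    have e2 := mod_ne_cutCol hvm hv ht₀ hkl hk (hcell w')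
    have hg := cutCol_lt (S := S) ht₀ k (rowLevel n m k) (cut m v₀ (w.Y (rowLevel n m k)))
    simp only [label, ← hzz] at h e1 e2
    refine le_trans ?_ (abs_coord_sub_le_dist z z' 0)
    rcases lt_or_gt_of_ne fun h' => h (Prod.ext rfl h') with hlt | hlt
    · exact le_abs_sub_of_word (by omega) (hz k).1.2 (hz' k).1.1
        (add_two_le_of_cut_lt hg hlt e1)
    · rw [abs_sub_comm]
      exact le_abs_sub_of_word (by omega) (hz' k).1.2 (hz k).1.1
        (add_two_le_of_cut_lt hg hlt e2)
  · have e1 := mod_ne_of_mem_rowSet hv (by omega) (w.Y_mem (rowLevel n m k))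
    have e2 := mod_ne_of_mem_rowSet hv (by omega) (w'.Y_mem (rowLevel n m k))
    have hlev : 1 / (n : ℝ) ^ k ≤ 1 / (m : ℝ) ^ rowLevel n m k := by
      refine one_div_le_one_div_of_le (by positivity) ?_
      exact_mod_cast pow_rowLevel_le hmn k
    refine hlev.trans (le_trans ?_ (abs_coord_sub_le_dist z z' 1))
    rcases lt_or_gt_of_ne hzz with hlt | hlt
    · exact le_abs_sub_of_word (by omega) (hz _).2.2 (hz' _).2.1
        (add_two_le_of_cut_lt hvm hlt e1)
    · rw [abs_sub_comm]
      exact le_abs_sub_of_word (by omega) (hz' _).2.2 (hz _).2.1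
        (add_two_le_of_cut_lt hvm hlt e2)

/-! ### The carpet as a sequence space -/

/-- The approximate squares of width `n ^ (-k)`. -/
abbrev LevelCell (S : DigitSystem n m a) (k : ℕ) : Type := {p // p ∈ S.cells k (rowLevel n m k)}

/-- The labels of the approximate squares of width `n ^ (-k)`; the single square of width `1` needs
no cuts. -/
def levelLabel (v₀ t₀ k : ℕ) (c : S.LevelCell k) : ℕ × ℕ :=
  if k = 0 then (0, 0) else S.label v₀ t₀ k (rowLevel n m k) c.1

/-- The approximate square of width `n ^ (-k)` of a digit sequence. -/
def Code.cell (hm : 2 ≤ m) (hmn : m < n) (w : S.Code) (k : ℕ) : S.LevelCell k :=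
  ⟨(w.X k, w.Y (rowLevel n m k)), w.mem_cells (self_le_rowLevel hm hmn k)⟩

theorem exists_level_parent (hm : 2 ≤ m) (hmn : m < n) (hvm : v₀ < m) (hv : v₀ ∉ S.J)
    (ht₀ : 2 * a ^ t₀ < n ^ t₀) {k k' : ℕ} (hkk' : k < k')
    (h : k = 0 ∨ (t₀ ≤ k ∧ k + t₀ ≤ k' ∧ k' + 1 ≤ rowLevel n m k ∧
      2 * n ^ t₀ ≤ 2 ^ (k' - k - 1))) :
    ∃ par : S.LevelCell k' → S.LevelCell k,
      (∀ w : S.Code, levelLabel v₀ t₀ k (par (w.cell hm hmn k')) =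
        levelLabel v₀ t₀ k (w.cell hm hmn k)) ∧
      (∀ c c', levelLabel v₀ t₀ k' c = levelLabel v₀ t₀ k' c' → par c = par c') ∧
      ∀ v, {u | par u = v}.encard =
        (a ^ (k' - k) * S.J.card ^ (rowLevel n m k' - rowLevel n m k) : ℕ) := by
  have hencard : ∀ P : ℕ × ℕ → Prop, ∀ _ : DecidablePred P, {u : S.LevelCell k' | P u.1}.encard =
      ((S.cells k' (rowLevel n m k')).filter P).card := by
    intro P _
    have hinj := Subtype.val_injective (p := fun p => p ∈ S.cells k' (rowLevel n m k'))
    rw [← Set.encard_coe_eq_coe_finsetCard, ← hinj.encard_image]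
    congr 1
    ext p
    constructor
    · rintro ⟨u, hu, rfl⟩
      exact Finset.mem_coe.2 (Finset.mem_filter.2 ⟨u.2, hu⟩)
    · intro hp
      obtain ⟨hp1, hp2⟩ := Finset.mem_filter.1 (Finset.mem_coe.1 hp)
      exact ⟨⟨p, hp1⟩, hp2, rfl⟩
  rcases h with rfl | ⟨h1, h2, h3, h4⟩
  · have hsub : ∀ c c' : S.LevelCell 0, c = c' := by
      rintro ⟨c, hc⟩ ⟨c', hc'⟩
      rw [rowLevel_zero, cells_zero, Finset.mem_singleton] at hc hc'
      exact Subtype.ext (hc.trans hc'.symm)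
    let c₀ : S.LevelCell 0 := ⟨(0, 0), by
      rw [rowLevel_zero, cells_zero]
      exact Finset.mem_singleton_self _⟩
    refine ⟨fun _ => c₀, fun w => rfl, fun _ _ _ => rfl, fun v => ?_⟩
    have hset : {u : S.LevelCell k' | c₀ = v} = {u | True} :=
      Set.ext fun u => ⟨fun _ => trivial, fun _ => hsub c₀ v⟩
    rw [hset, hencard (fun _ => True) (fun _ => inferInstance), Finset.filter_true,
      card_cells S (self_le_rowLevel hm hmn k'), rowLevel_zero, Nat.sub_zero, Nat.sub_zero]
  · obtain ⟨t, rfl⟩ := Nat.exists_eq_add_of_le hkk'.le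
    have hr := rowLevel_add_le hm hmn k t
    obtain ⟨r, hr'⟩ := Nat.exists_eq_add_of_le (show rowLevel n m k ≤ rowLevel n m (k + t) by omega)
    have hM : 2 ≤ S.J.card → 2 * n ^ t₀ ≤ S.J.card ^ (r - 1) := by
      intro hJ
      refine h4.trans ((Nat.pow_le_pow_right (by omega) ?_).trans (Nat.pow_le_pow_left hJ _))
      omega
    have hk0 : k ≠ 0 := by
      rintro rfl
      rw [rowLevel_zero] at h3
      omega
    obtain ⟨F, hF1, hF2, hF3⟩ := exists_parent hvm hv ht₀ h1 (show t₀ ≤ t by omega)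
      (show k + t + 1 ≤ rowLevel n m k by omega) (show 1 ≤ r by omega) hM
    rw [← hr'] at hF1 hF2 hF3
    refine ⟨fun c => ⟨F c.1, (hF1 c.1 c.2).1⟩, fun w => ?_, fun c c' hcc => ?_, fun v => ?_⟩
    · rw [levelLabel, levelLabel, if_neg hk0, if_neg hk0]
      have h5 := (hF1 _ (w.cell hm hmn (k + t)).2).2
      rw [h5]
      simp only [Code.cell]
      rw [w.X_add_div, hr', w.Y_add_div]
    · rw [levelLabel, levelLabel, if_neg (by omega), if_neg (by omega)] at hcc
      exact Subtype.ext (hF3 _ c.2 _ c'.2 hcc)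
    · have hset : {u : S.LevelCell (k + t) | (⟨F u.1, (hF1 u.1 u.2).1⟩ : S.LevelCell k) = v} =
          {u | F u.1 = v.1} :=
        Set.ext fun u => ⟨fun h => congrArg Subtype.val h, fun h => Subtype.ext h⟩
      rw [hset, hencard (fun p => F p = v.1) (fun _ => inferInstance), hF2 v.1 v.2, hr',
        Nat.add_sub_cancel_left, Nat.add_sub_cancel_left]

open Filter Topology in
/-- A self-affine carpet with a vacant row and equally many, but not all, digits in the other rows is
a sequence space, with the branching of the approximate squares along a sequence of levels. -/
theorem SelfAffine.lipEquiv {E : Set (EuclideanSpace ℝ (Fin 2))} (hE : S.SelfAffine E)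
    (hm : 2 ≤ m) (hmn : m < n) (ha : 0 < a) (han : a < n) (hJ : S.J.Nonempty) (hvm : v₀ < m)
    (hv : v₀ ∉ S.J) (hne : E.Nonempty) (hc : IsCompact E) :
    ∃ (κ : ℕ → ℕ) (b : ℕ), κ 0 = 0 ∧ StrictMono κ ∧ (∀ K, κ (K + 1) ≤ κ K + b) ∧
      LipEquiv (fun x y : E => dist x y)
        (levelDist (fun K => (1 / (n : ℝ)) ^ κ K) : (∀ K, Fin (a ^ (κ (K + 1) - κ K) *
          S.J.card ^ (rowLevel n m (κ (K + 1)) - rowLevel n m (κ K)))) → _ → ℝ) := by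
  obtain ⟨t₀, ht₀⟩ := exists_mul_pow_lt han 2
  -- Blocks of `t` levels satisfy `2 * n ^ t₀ ≤ 2 ^ (t - 1)`, so that the exceptional clusters are
  -- few. The levels start so late that `k + t < rowLevel n m k`: the rows of a square of level `k`
  -- are already known to the depth of the `t` columns that the next block adds.
  set t := 2 * n ^ t₀ + t₀ + 1 with ht
  obtain ⟨k₁, hk₁⟩ := exists_add_le_rowLevel hm hmn (t + 1)
  set k₀ := k₁ + t₀ + 1 with hk₀
  let κ : ℕ → ℕ := fun K => Nat.casesOn K 0 fun K => k₀ + t * K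
  have hκ0 : κ 0 = 0 := rfl
  have hκ1 : κ (0 + 1) = k₀ := by simp [κ]
  have hκs : ∀ K, κ (K + 2) = κ (K + 1) + t := fun K => by
    simp only [κ]
    ring
  have hκge : ∀ K, k₀ ≤ κ (K + 1) := fun K => Nat.le_add_right _ _
  have hmono : StrictMono κ := strictMono_nat_of_lt_succ fun K => by
    cases K with
    | zero => rw [hκ0, hκ1]; omega
    | succ K => rw [hκs]; omega
  have hb : ∀ K, κ (K + 1) ≤ κ K + (k₀ + t) := fun K => by
    cases K with
    | zero => rw [hκ0, hκ1]; omega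
    | succ K => rw [hκs]; omega
  refine ⟨κ, k₀ + t, hκ0, hmono, hb, ?_⟩
  have hlev : ∀ K, κ (K + 1) + t + 1 ≤ rowLevel n m (κ (K + 1)) := fun K =>
    hk₁ _ (by have := hκge K; omega)
  have hpar : ∀ K, κ K = 0 ∨ (t₀ ≤ κ K ∧ κ K + t₀ ≤ κ (K + 1) ∧
      κ (K + 1) + 1 ≤ rowLevel n m (κ K) ∧ 2 * n ^ t₀ ≤ 2 ^ (κ (K + 1) - κ K - 1)) := by
    intro K
    cases K with
    | zero => exact Or.inl rfl
    | succ K =>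
      refine Or.inr ⟨by have := hκge K; omega, by rw [hκs]; omega, by rw [hκs]; exact hlev K, ?_⟩
      rw [hκs, Nat.add_sub_cancel_left]
      exact Nat.lt_two_pow_self.le.trans (Nat.pow_le_pow_right (by omega) (by omega))
  choose par hpar1 hpar2 hpar3 using fun K => exists_level_parent (S := S) hm hmn hvm hv ht₀
    (hmono (Nat.lt_succ_self K)) (hpar K)
  have hunit := hE.mem_unit (by omega) hm hne hc
  have hn1 : (1 : ℝ) < n := by exact_mod_cast (by omega : 1 < n)
  have hm0 : (0 : ℝ) ≤ m := Nat.cast_nonneg m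
  have hρ0 : 0 < 1 / (n : ℝ) := by positivity
  have hρ1 : 1 / (n : ℝ) < 1 := (div_lt_one (by linarith)).2 hn1
  have : CompleteSpace E := hc.isComplete.completeSpace_coe
  have hC1 : (1 : ℝ) ≤ n ^ t₀ := one_le_pow₀ hn1.le
  have hC2 : (1 : ℝ) ≤ n ^ (k₀ + t) := one_le_pow₀ hn1.le
  have hsub : ∀ c c' : S.LevelCell (κ 0), c = c' := by
    rintro ⟨c, hc⟩ ⟨c', hc'⟩
    rw [hκ0, rowLevel_zero, cells_zero, Finset.mem_singleton] at hc hc'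
    exact Subtype.ext (hc.trans hc'.symm)
  obtain ⟨z₀, hz₀⟩ := hne
  obtain ⟨w₀, -⟩ := hE.exists_coded hunit hz₀
  refine lipEquiv_of_clusters (R := fun x (w : S.Code) => Coded x.1 w)
    (fun x => hE.exists_coded hunit x.2)
    (fun w => by
      obtain ⟨z, hz, hzw⟩ := hE.exists_point (by omega) hm ⟨z₀, hz₀⟩ hc hunit w
      exact ⟨⟨z, hz⟩, hzw⟩)
    (fun w K => w.cell hm hmn (κ K)) ?_ (v₀ := w₀.cell hm hmn (κ 0)) (fun v => hsub _ _)
    (fun K => levelLabel v₀ t₀ (κ K)) par hpar1 hpar2 hpar3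
    (C := (n ^ t₀ + m * m + 1) * n ^ (k₀ + t)) (by nlinarith [mul_nonneg hm0 hm0]) ?_ ?_
    (fun K => by positivity) ?_ ?_
  · rintro K ⟨p, hp⟩
    obtain ⟨w, h1, h2⟩ := exists_code ha hJ (self_le_rowLevel hm hmn (κ K)) hp
    exact ⟨w, Subtype.ext (Prod.ext h1 h2)⟩
  · intro x x' w w' K hx hx' h
    have hCle : (n : ℝ) ^ t₀ + m * m + 1 ≤ (n ^ t₀ + m * m + 1) * n ^ (k₀ + t) :=
      le_mul_of_one_le_right (by positivity) hC2
    refine le_trans ?_ (mul_le_mul_of_nonneg_right hCle (by positivity))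
    cases K with
    | zero =>
      rw [hκ0, pow_zero, mul_one]
      refine (dist_le_add_abs x.1 x'.1).trans ?_
      obtain ⟨a1, a2⟩ := hunit x.1 x.2
      obtain ⟨b1, b2⟩ := hunit x'.1 x'.2
      have d0 : |x.1 0 - x'.1 0| ≤ 1 := abs_le.2 ⟨by linarith, by linarith⟩
      have d1 : |x.1 1 - x'.1 1| ≤ 1 := abs_le.2 ⟨by linarith, by linarith⟩
      have := mul_nonneg hm0 hm0
      linarith
    | succ K =>
      have hne0 : κ (K + 1) ≠ 0 := by have := hκge K; omega
      rw [levelLabel, levelLabel, if_neg hne0, if_neg hne0] at h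
      refine (dist_le_of_label_eq hm hmn hvm ht₀ hx hx' h).trans ?_
      exact mul_le_mul_of_nonneg_right (by linarith) (by positivity)
  · intro x x' w w' K hx hx' h
    cases K with
    | zero => exact absurd rfl h
    | succ K =>
      have hge := hκge K
      have hl := hlev K
      have hne0 : κ (K + 1) ≠ 0 := by omega
      rw [levelLabel, levelLabel, if_neg hne0, if_neg hne0] at h
      refine (le_dist_of_label_ne hm hmn hvm hv ht₀ (by omega) (by omega) hx hx' h).trans ?_
      refine le_mul_of_one_le_left dist_nonneg ?_
      nlinarith [mul_nonneg hm0 hm0]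
  · intro K
    have h1 : (1 : ℝ) ≤ n ^ t₀ + m * m + 1 := by nlinarith [mul_nonneg hm0 hm0]
    have h2 : (1 / (n : ℝ)) ^ κ K = n ^ (k₀ + t) * (1 / (n : ℝ)) ^ (κ K + (k₀ + t)) := by
      rw [pow_add _ (κ K), one_div_pow (n : ℝ) (k₀ + t), mul_left_comm,
        mul_one_div_cancel (by positivity), mul_one]
    have h3 : (1 / (n : ℝ)) ^ (κ K + (k₀ + t)) ≤ (1 / (n : ℝ)) ^ κ (K + 1) :=
      pow_le_pow_of_le_one hρ0.le hρ1.le (hb K)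
    rw [h2, mul_assoc]
    exact (mul_le_mul_of_nonneg_left h3 (by positivity)).trans
      (le_mul_of_one_le_left (by positivity) h1)
  · exact (tendsto_pow_atTop_nhds_zero_of_lt_one hρ0.le hρ1).comp hmono.tendsto_atTop

end DigitSystem

open Filter Topology

/-! ### The digit system of a carpet -/

section ofFinset

variable {n m a : ℕ} {D : Finset (Fin n × Fin m)}

/-- The digit system of a set of digits with uniform horizontal fibers. -/
def DigitSystem.ofFinset (D : Finset (Fin n × Fin m))
    (h : ∀ j, 0 < rowCount D j → rowCount D j = a) : DigitSystem n m a where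
  R y := (D.filter fun d => (d.2 : ℕ) = y).image fun d => (d.1 : ℕ)
  J := D.image fun d => (d.2 : ℕ)
  R_lt y x hx := by
    obtain ⟨d, -, rfl⟩ := Finset.mem_image.1 hx
    exact d.1.2
  J_lt y hy := by
    obtain ⟨d, -, rfl⟩ := Finset.mem_image.1 hy
    exact d.2.2
  card_R y hy := by
    obtain ⟨d, hd, rfl⟩ := Finset.mem_image.1 hy
    have h1 : (D.filter fun e => (e.2 : ℕ) = (d.2 : ℕ)) = D.filter fun e => e.2 = d.2 := by
      simp only [Fin.val_inj]
    rw [Finset.card_image_of_injOn, h1]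
    · exact h d.2 (Finset.card_pos.2 ⟨d, Finset.mem_filter.2 ⟨hd, rfl⟩⟩)
    · intro e he e' he' hee
      simp only [Finset.coe_filter, Set.mem_ofPred_eq] at he he'
      exact Prod.ext (Fin.ext hee) (Fin.ext (he.2.trans he'.2.symm))
  R_eq_empty y hy := by
    rw [Finset.image_eq_empty, Finset.filter_eq_empty_iff]
    exact fun d hd hdy => hy (Finset.mem_image.2 ⟨d, hd, hdy⟩)

variable (h : ∀ j, 0 < rowCount D j → rowCount D j = a)

theorem rowCount_pos {d : Fin n × Fin m} (hd : d ∈ D) : 0 < rowCount D d.2 :=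
  Finset.card_pos.2 ⟨d, Finset.mem_filter.2 ⟨hd, rfl⟩⟩

theorem mem_ofFinset_R {x y : ℕ} :
    x ∈ (DigitSystem.ofFinset D h).R y ↔ ∃ d ∈ D, (d.1 : ℕ) = x ∧ (d.2 : ℕ) = y := by
  simp only [DigitSystem.ofFinset, Finset.mem_image, Finset.mem_filter]
  constructor
  · rintro ⟨d, ⟨h1, h2⟩, h3⟩
    exact ⟨d, h1, h3, h2⟩
  · rintro ⟨d, h1, h3, h2⟩
    exact ⟨d, ⟨h1, h2⟩, h3⟩

theorem card_ofFinset_J : (DigitSystem.ofFinset D h).J.card = numRows D := by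
  have h1 : (DigitSystem.ofFinset D h).J =
      (Finset.univ.filter fun j : Fin m => 0 < rowCount D j).image Fin.val := by
    ext y
    simp only [DigitSystem.ofFinset, Finset.mem_image, Finset.mem_filter, Finset.mem_univ, true_and]
    constructor
    · rintro ⟨d, hd, rfl⟩
      exact ⟨d.2, rowCount_pos hd, rfl⟩
    · rintro ⟨j, hj, rfl⟩
      obtain ⟨d, hd⟩ := Finset.card_pos.1 hj
      obtain ⟨h1, h2⟩ := Finset.mem_filter.1 hd
      exact ⟨d, h1, by rw [h2]⟩
  rw [h1, Finset.card_image_of_injective _ Fin.val_injective, numRows]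

theorem card_eq_mul_numRows (h : ∀ j, 0 < rowCount D j → rowCount D j = a) :
    D.card = a * numRows D := by
  rw [numRows, mul_comm, ← smul_eq_mul, ← Finset.sum_const,
    Finset.card_eq_sum_card_fiberwise (f := Prod.snd) (t := Finset.univ) (by simp),
    Finset.sum_filter]
  refine Finset.sum_congr rfl fun j _ => ?_
  split_ifs with hj
  · exact h j hj
  · rw [rowCount, not_lt, Nat.le_zero] at hj
    exact hj

theorem selfAffine_ofFinset {E : Set (EuclideanSpace ℝ (Fin 2))} (hn : 0 < n) (hm : 0 < m)
    (hE : E = ⋃ d ∈ D, S n m d '' E) : (DigitSystem.ofFinset D h).SelfAffine E := by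
  have hn0 : (n : ℝ) ≠ 0 := by exact_mod_cast hn.ne'
  have hm0 : (m : ℝ) ≠ 0 := by exact_mod_cast hm.ne'
  have hS : ∀ d z z', S n m d z' = z ↔
      n * z 0 = z' 0 + (d.1 : ℕ) ∧ m * z 1 = z' 1 + (d.2 : ℕ) := by
    intro d z z'
    have h0 : (S n m d z') 0 = (z' 0 + (d.1 : ℕ)) / n := rfl
    have h1 : (S n m d z') 1 = (z' 1 + (d.2 : ℕ)) / m := rfl
    constructor
    · rintro rfl
      rw [h0, h1]
      constructor <;> field_simp
    · rintro ⟨e0, e1⟩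
      ext i
      fin_cases i
      · change (S n m d z') 0 = z 0
        rw [h0, ← e0]
        field_simp
      · change (S n m d z') 1 = z 1
        rw [h1, ← e1]
        field_simp
  intro z
  conv_lhs => rw [hE]
  simp only [Set.mem_iUnion, Set.mem_image, mem_ofFinset_R, hS]
  constructor
  · rintro ⟨d, hd, z', hz', h1⟩
    exact ⟨_, _, ⟨d, hd, rfl, rfl⟩, z', hz', h1⟩
  · rintro ⟨_, _, ⟨d, hd, rfl, rfl⟩, z', hz', h1⟩
    exact ⟨d, hd, z', hz', h1⟩

end ofFinset

/-! ### Full rows contain segments -/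

theorem eq_of_words {b : ℕ} (hb : 2 ≤ b) {X : ℕ → ℕ} {u u' : ℝ}
    (h : ∀ k, (X k : ℝ) ≤ b ^ k * u ∧ b ^ k * u ≤ X k + 1)
    (h' : ∀ k, (X k : ℝ) ≤ b ^ k * u' ∧ b ^ k * u' ≤ X k + 1) : u = u' := by
  have hb1 : (1 : ℝ) < b := by exact_mod_cast (by omega : 1 < b)
  have hlim : Tendsto (fun k : ℕ => (1 / (b : ℝ)) ^ k) atTop (𝓝 0) :=
    tendsto_pow_atTop_nhds_zero_of_lt_one (by positivity) ((div_lt_one (by linarith)).2 hb1)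
  have hle : |u - u'| ≤ 0 := by
    refine ge_of_tendsto' hlim fun k => ?_
    have := DigitSystem.abs_sub_le_of_word (c := 1) (by omega : 0 < b) (h k).1 (h k).2 (h' k).1
      (h' k).2 (Nat.lt_succ_self _) (Nat.lt_succ_self _)
    rwa [Nat.cast_one, ← one_div_pow] at this
  exact sub_eq_zero.1 (abs_nonpos_iff.1 hle)

/-- A carpet with a full row contains a horizontal segment. -/
theorem DigitSystem.SelfAffine.not_full_row {n m a : ℕ} {S : DigitSystem n m a}
    {E : Set (EuclideanSpace ℝ (Fin 2))} (hE : S.SelfAffine E) (hn : 2 ≤ n) (hm : 2 ≤ m)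
    (hne : E.Nonempty) (hc : IsCompact E) (htd : IsTotallyDisconnected E) (y : ℕ) :
    ∃ x < n, x ∉ S.R y := by
  by_contra! hfull
  have hunit := hE.mem_unit hn hm hne hc
  have hn0 : (n : ℝ) ≠ 0 := by exact_mod_cast (by omega : n ≠ 0)
  let code : ℝ → S.Code := fun u => ⟨fun i => (⌊(n : ℝ) ^ (i + 1) * u⌋₊ % n, y),
    fun i => hfull _ (Nat.mod_lt _ (by omega))⟩
  have hX : ∀ u, u < 1 → ∀ k, (code u).X k = ⌊(n : ℝ) ^ k * u⌋₊ := by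
    intro u hu k
    induction k with
    | zero =>
      rw [pow_zero, one_mul, Nat.floor_eq_zero.2 hu]
      rfl
    | succ k ih =>
      have h1 : ⌊(n : ℝ) ^ k * u⌋₊ = ⌊(n : ℝ) ^ (k + 1) * u⌋₊ / n := by
        rw [← Nat.floor_div_natCast]
        congr 1
        rw [pow_succ]
        field_simp
      rw [Code.X_succ, ih, h1]
      exact Nat.div_add_mod _ n
  have hY : ∀ u u' k, (code u).Y k = (code u').Y k := fun u u' k => rfl
  choose pt hptE hpt using fun u => hE.exists_point hn hm hne hc hunit (code u)
  have hpt0 : ∀ u ∈ Set.Ico (0 : ℝ) 1, pt u 0 = u := by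
    intro u hu
    refine eq_of_words hn (X := (code u).X) (fun k => (hpt u k).1) fun k => ?_
    rw [hX u hu.2 k]
    exact ⟨Nat.floor_le (mul_nonneg (by positivity) hu.1), (Nat.lt_floor_add_one _).le⟩
  have hpt1 : ∀ u, pt u 1 = pt 0 1 := fun u =>
    eq_of_words hm (X := (code u).Y) (fun k => (hpt u k).2) fun k => (hpt 0 k).2
  have hseg : ∀ u ∈ Set.Ico (0 : ℝ) 1, !₂[u, pt 0 1] = pt u := by
    intro u hu
    ext i
    fin_cases i
    · exact (hpt0 u hu).symm
    · exact (hpt1 u).symm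
  have hcont : Continuous fun u : ℝ => (!₂[u, pt 0 1] : EuclideanSpace ℝ (Fin 2)) := by
    refine (PiLp.continuous_toLp 2 _).comp (continuous_pi fun i => ?_)
    fin_cases i
    · exact continuous_id
    · exact continuous_const
  have hsub := htd ((fun u : ℝ => (!₂[u, pt 0 1] : EuclideanSpace ℝ (Fin 2))) '' Set.Ico 0 1)
    (by
      rintro _ ⟨u, hu, rfl⟩
      simp only [hseg u hu]
      exact hptE u)
    (isPreconnected_Ico.image _ hcont.continuousOn)
  have h2 := hsub (Set.mem_image_of_mem _ (Set.mem_Ico.2 ⟨le_refl (0 : ℝ), zero_lt_one⟩))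
    (Set.mem_image_of_mem _ (Set.mem_Ico.2 ⟨(by norm_num : (0 : ℝ) ≤ 1 / 2), by norm_num⟩))
  have h3 : (0 : ℝ) = 1 / 2 := congrArg (fun z : EuclideanSpace ℝ (Fin 2) => z 0) h2
  norm_num at h3

/-! ### The numbers `n_k` -/

section nSeq

variable {n m a : ℕ}

theorem floor_div_sigma (k : ℕ) : ⌊(k : ℝ) * (1 / sigma n m)⌋ = rowLevel n m k := by
  have h1 : (k : ℝ) * (1 / sigma n m) = Real.logb m ((n ^ k : ℕ) : ℝ) := by
    rw [sigma, one_div_div, Real.logb, Nat.cast_pow, Real.log_pow]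
    ring
  rw [h1, Real.floor_logb_natCast (Nat.cast_nonneg _), Int.log_natCast, rowLevel]

theorem floor_mul_alpha (k : ℕ) :
    ⌊(k : ℝ) * alpha n m⌋ = rowLevel n m k - k * ⌊1 / sigma n m⌋ := by
  rw [← floor_div_sigma k, ← Int.floor_sub_intCast]
  congr 1
  rw [alpha]
  push_cast
  ring

theorem expo_succ (k : ℕ) :
    expo n m (k + 1) = rowLevel n m (k + 1) - rowLevel n m k - 1 := by
  have h1 := floor_mul_alpha (n := n) (m := m) (k + 1)
  have h2 := floor_mul_alpha (n := n) (m := m) k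
  rw [expo, delta, h1, show ((k + 1 : ℕ) : ℝ) - 1 = k by push_cast; ring, h2]
  push_cast
  ring

theorem nSeq_succ {D : Finset (Fin n × Fin m)} (hm : 2 ≤ m) (hmn : m < n)
    (hD : D.card = a * numRows D) (k : ℕ) :
    nSeq D (k + 1) = a * numRows D ^ (rowLevel n m (k + 1) - rowLevel n m k) := by
  have h1 := rowLevel_add_le hm hmn k 1
  rw [nSeq, expo_succ, hD, mul_assoc, ← pow_succ']
  congr 2
  omega

theorem prod_nSeq {D : Finset (Fin n × Fin m)} (hm : 2 ≤ m) (hmn : m < n)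
    (hD : D.card = a * numRows D) {k k' : ℕ} (hk : k ≤ k') :
    ∏ i ∈ Finset.Ico k k', nSeq D (i + 1) =
      a ^ (k' - k) * numRows D ^ (rowLevel n m k' - rowLevel n m k) := by
  obtain ⟨d, rfl⟩ := Nat.exists_eq_add_of_le hk
  rw [Nat.add_sub_cancel_left]
  clear hk
  induction d with
  | zero => simp
  | succ d ih =>
    have h1 := rowLevel_add_le hm hmn k d
    have h2 := rowLevel_add_le hm hmn (k + d) 1
    rw [← Nat.add_assoc, Finset.prod_Ico_succ_top (by omega), ih, nSeq_succ hm hmn hD,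
      show rowLevel n m (k + d + 1) - rowLevel n m k =
        rowLevel n m (k + d) - rowLevel n m k +
          (rowLevel n m (k + d + 1) - rowLevel n m (k + d)) by omega, pow_add, pow_succ]
    ring

/-- Grouping the levels of `Ω` into blocks. -/
theorem lipEquiv_omega_blocks {D : Finset (Fin n × Fin m)} (hmn : m < n) {c κ : ℕ → ℕ} {b : ℕ}
    (hκ0 : κ 0 = 0) (hκ : StrictMono κ) (hb : ∀ K, κ (K + 1) ≤ κ K + b)
    (hc : ∀ K, c K = ∏ i ∈ Finset.Ico (κ K) (κ (K + 1)), nSeq D (i + 1)) :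
    LipEquiv (fun x y : Omega D => prefixDist (1 / (n : ℝ)) x y)
      (levelDist (fun K => (1 / (n : ℝ)) ^ κ K) : (∀ K, Fin (c K)) → _ → ℝ) := by
  have hn : (1 : ℝ) ≤ n := by exact_mod_cast (by omega : 1 ≤ n)
  have h1 : 1 / (n : ℝ) ≤ 1 := (div_le_one (by linarith)).2 hn
  refine lipEquiv_blocks (ρ := fun k => (1 / (n : ℝ)) ^ k) hκ0 hκ hb hc (fun k => by positivity)
    (fun i j hij => pow_le_pow_of_le_one (by positivity) h1 hij) hn fun k => le_of_eq ?_
  rw [pow_succ']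
  field_simp

theorem pow_eq_pow_of_sigma (hm : 2 ≤ m) (hmn : m < n) {p q : ℕ} (hq : 0 < q)
    (h : sigma n m = (p : ℝ) / (q : ℝ)) : m ^ q = n ^ p := by
  have hm0 : (0 : ℝ) < m := by exact_mod_cast (by omega : 0 < m)
  have hn0 : (0 : ℝ) < n := by exact_mod_cast (by omega : 0 < n)
  have hlog : Real.log n ≠ 0 := (Real.log_pos (by exact_mod_cast (by omega : 1 < n))).ne'
  have hq0 : (q : ℝ) ≠ 0 := by exact_mod_cast hq.ne'
  rw [sigma, div_eq_div_iff hlog hq0] at h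
  have h1 : (m : ℝ) ^ q = (n : ℝ) ^ p := by
    refine Real.log_injOn_pos (Set.mem_Ioi.2 (by positivity)) (Set.mem_Ioi.2 (by positivity)) ?_
    rw [Real.log_pow, Real.log_pow]
    linarith
  exact_mod_cast h1

end nSeq

end Carpet

end

theorem theorem1p2 (n m : ℕ) (hm : 2 ≤ m) (hmn : m < n)
    (D : Finset (Fin n × Fin m)) (hN : 1 < D.card)
    (E : Set (EuclideanSpace ℝ (Fin 2))) (hE : Carpet.IsCarpet n m D E)
    (htd : IsTotallyDisconnected E) (hvac : Carpet.HasVacantRow D)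
    (hunif : Carpet.UniformFibers D) :
    Carpet.LipEquiv (fun x y : E => dist x y)
      (fun x y : Carpet.Omega D => Carpet.prefixDist (1 / (n : ℝ)) x y) ∧
    (∀ p q : ℕ, 0 < p → 0 < q → Carpet.sigma n m = (p : ℝ) / (q : ℝ) →
      Carpet.LipEquiv (fun x y : E => dist x y)
        (fun x y : ℕ → Fin (D.card ^ p * Carpet.numRows D ^ (q - p)) =>
          Carpet.prefixDist (1 / (n : ℝ) ^ p) x y)) ∧
    (∀ {V : Type*} (T : SimpleGraph V) (r : V),
      Carpet.IsHomogeneousTree T r (Carpet.nSeq D) →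
        Carpet.LipEquiv (fun x y : E => dist x y)
          (Carpet.boundaryDist T r (1 / (n : ℝ)))) := by
  open Carpet in
  obtain ⟨hne, hc, hEq⟩ := hE
  obtain ⟨d₀, hd₀⟩ := Finset.card_pos.1 (by omega : 0 < D.card)
  have ha := rowCount_pos hd₀
  have hrow : ∀ j, 0 < rowCount D j → rowCount D j = rowCount D d₀.2 := fun j hj =>
    hunif j d₀.2 hj ha
  generalize rowCount D d₀.2 = a at ha hrow
  have hD := card_eq_mul_numRows hrow
  have hSA := selfAffine_ofFinset hrow (by omega) (by omega) hEq
  have hJd : (d₀.2 : ℕ) ∈ (DigitSystem.ofFinset D hrow).J :=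
    Finset.mem_image.2 ⟨d₀, hd₀, rfl⟩
  have han : a < n := by
    obtain ⟨x, hx, hxR⟩ := hSA.not_full_row (by omega) hm hne hc htd d₀.2
    have h1 : ((DigitSystem.ofFinset D hrow).R d₀.2).card < (Finset.range n).card := by
      refine Finset.card_lt_card (Finset.ssubset_iff_of_subset ?_ |>.2
        ⟨x, Finset.mem_range.2 hx, hxR⟩)
      exact fun i hi => Finset.mem_range.2 ((DigitSystem.ofFinset D hrow).R_lt _ i hi)
    rwa [(DigitSystem.ofFinset D hrow).card_R _ hJd, Finset.card_range] at h1
  obtain ⟨j₀, hj₀⟩ := hvac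
  have hv : (j₀ : ℕ) ∉ (DigitSystem.ofFinset D hrow).J := by
    intro h
    obtain ⟨d, hd, hdj⟩ := Finset.mem_image.1 h
    have := rowCount_pos hd
    rw [Fin.ext hdj, hj₀] at this
    exact lt_irrefl 0 this
  have hn0 : (0 : ℝ) < n := by exact_mod_cast (by omega : 0 < n)
  have h1 : LipEquiv (fun x y : E => dist x y)
      (fun x y : Omega D => prefixDist (1 / (n : ℝ)) x y) := by
    obtain ⟨κ, b, hκ0, hκ, hb, hlip⟩ :=
      hSA.lipEquiv hm hmn ha han ⟨_, hJd⟩ j₀.2 hv hne hc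
    refine hlip.trans (lipEquiv_omega_blocks hmn hκ0 hκ hb fun K => ?_).symm
    rw [prod_nSeq hm hmn hD (hκ (Nat.lt_succ_self K)).le, card_ofFinset_J]
  refine ⟨h1, fun p q hp hq hσ => ?_, fun T r hT => ?_⟩
  · have hpow := pow_eq_pow_of_sigma hm hmn hq hσ
    have hlev : ∀ K, rowLevel n m (p * K) = q * K := fun K => by
      rw [rowLevel, pow_mul, ← hpow, ← pow_mul, Nat.log_pow (by omega)]
    have hpq : p ≤ q := by
      by_contra! hlt
      have h2 := Nat.pow_le_pow_left hmn.le p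
      have h3 := Nat.pow_lt_pow_right (by omega : 1 < m) hlt
      omega
    have h2 := lipEquiv_omega_blocks (D := D) (κ := fun K => p * K) (b := p)
      (c := fun _ => D.card ^ p * numRows D ^ (q - p)) hmn (mul_zero p)
      (fun i j hij => Nat.mul_lt_mul_of_pos_left hij hp) (fun K => by rw [mul_add, mul_one])
      (fun K => by
        rw [prod_nSeq hm hmn hD (Nat.mul_le_mul_left p (Nat.le_succ K)), hlev, hlev, hD, mul_pow,
          mul_assoc, ← pow_add, Nat.succ_eq_add_one, mul_add, mul_add, mul_one, mul_one,
          Nat.add_sub_cancel_left, Nat.add_sub_cancel_left, Nat.add_sub_cancel' hpq])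
    refine h1.trans ?_
    have hρ : (fun K : ℕ => (1 / (n : ℝ)) ^ (p * K)) = fun K => (1 / (n : ℝ) ^ p) ^ K := by
      funext K
      rw [pow_mul, one_div_pow]
    rw [hρ] at h2
    exact h2
  · refine h1.trans (lipEquiv_boundary hT (by positivity) ?_).symm
    exact (div_le_one hn0).2 (by exact_mod_cast (by omega : 1 ≤ n))
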